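/- Let $\mathcal H$ be a separable complex Hilbert space and let $S_1,S_2$ be self-adjoint operators in $\mathcal H$, bounded from below, such that $(S_2-z)^{-1}-(S_1-z)^{-1}$ is trace class for some $z\in\rho(S_1)\cap\rho(S_2)$, and such that, for some $\lambda_1>0$, $\sigma_{ess}(S_j)\subseteq[\lambda_1,\infty)$, $j=1,2$. Let $m(0;S_j)=\dim\ker S_j$, let $P(0;S_j)$ be the orthogonal projection onto $\ker S_j$, and put $$F(z)=\operatorname{tr}\big((S_2-z)^{-1}[I-P(0;S_2)]-(S_1-z)^{-1}[I-P(0;S_1)]\big).$$ Assume that for all $z\in\mathbb C\setminus[\inf(\sigma(S_1)\cup\sigma(S_2)),\infty)$ the closure of $(S_2-z)^{1/2}(S_1-z)^{-1}(S_2-z)^{1/2}$ is a bounded operator on $\mathcal H$ that differs from $I$ by a trace class operator, that its Fredholm determinant $D(z)=\det\big(\overline{(S_2-z)^{1/2}(S_1-z)^{-1}(S_2-z)^{1/2}}\big)$ is nonzero and differentiable in $z$, and that $$\operatorname{tr}\big((S_2-z)^{-1}-(S_1-z)^{-1}\big)=-\frac{d}{dz}\ln D(z)=-\frac{D'(z)}{D(z)}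 .$$ Let $\theta\in(\pi/2,\pi)$, let $R_\theta=\{te^{i\theta}: t\ge 0\}$, and let $z^{-s}=e^{-s\ln z}$ with the branch of the logarithm with $\arg z\in(\theta-2\pi,\theta]$ (branch cut $R_\theta$). Let $\gamma$ be a counterclockwise contour of the following form: for real numbers $0<r<a$, $0<\kappa<\eta$, $0\le\varphi<\pi/2$ with $-r\sin\theta<\eta\cos\theta$, it comes in from infinity along the ray $\{r+i\eta+ue^{i\varphi}:u\ge0\}$, runs along the straight segments joining successively $r+i\eta$, $r-i\kappa$, $-r-i\kappa$, $-r+i\eta$, $-a+i\eta$, $-a-i\eta$, $r-i\eta$, and goes out to infinity along $\{r-i\eta+ue^{-i\varphi}:u\ge0\}$. (Thus $\gamma$ dips under $0$, does not meet $R_\theta$, and $0$ is not enclosed.) Assume that $\gamma$ encloses $(\sigma(S_1)\cup\sigma(S_2))\setminus\{0\}$. The relative spectral $\zeta$-function of $(S_1,S_2)$ is $$\zeta(s;S_1,S_2)=-\frac1{2\pi i}\oint_\gamma z^{-s}F(z)\,dz$$ for all $s$ for which the integral converges. Assume in addition that for some $\varepsilon>0$, $F(z)=O(|z|^{-1-\varepsilon})$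 as $|z|\to\infty$ with $z$ on or outside $\gamma$, and $F(z)=O(1)$ as $z\to0$, $z\neq0$. Then the integral defining $\zeta(s;S_1,S_2)$ converges absolutely for all $s$ with $\operatorname{Re}(s)>-\varepsilon$, and for $\operatorname{Re}(s)\in(-\varepsilon,1)$ the integral on the right-hand side below converges absolutely and $$\zeta(s;S_1,S_2)=e^{is(\pi-\theta)}\,\frac{\sin(\pi s)}{\pi}\int_0^\infty t^{-s}\,\frac{d}{dt}\ln\Big((e^{i\theta}t)^{m(0;S_1)-m(0;S_2)}\,D(e^{i\theta}t)\Big)\,dt ,$$ where $\frac{d}{dt}\ln G=G'/G$. -/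

import Mathlib

open Set Filter Topology MeasureTheory Asymptotics
open scoped InnerProductSpace

noncomputable section

namespace RelZeta

variable {H : Type*} [NormedAddCommGroup H] [InnerProductSpace ℂ H] [CompleteSpace H]

/-! ### Unbounded operators: resolvent, spectrum, kernel -/

/-- `R` is the bounded, everywhere defined, two-sided inverse of `A - z`. -/
def IsResolventAt (A : H →ₗ.[ℂ] H) (z : ℂ) (R : H →L[ℂ] H) : Prop :=
  (∀ y : H, ∃ x : A.domain, (x : H) = R y ∧ A x - z • (x : H) = y) ∧
    ∀ x : A.domain, R (A x - z • (x : H)) = x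

/-- The resolvent set `ρ(A)`. -/
def resolventSet (A : H →ₗ.[ℂ] H) : Set ℂ := {z | ∃ R : H →L[ℂ] H, IsResolventAt A z R}

open Classical in
/-- The resolvent `(A - z)⁻¹` for `z ∈ ρ(A)` (and `0` otherwise). -/
def resolvent (A : H →ₗ.[ℂ] H) (z : ℂ) : H →L[ℂ] H :=
  if h : ∃ R : H →L[ℂ] H, IsResolventAt A z R then h.choose else 0

/-- The spectrum `σ(A)`. -/
def spectrum (A : H →ₗ.[ℂ] H) : Set ℂ := (resolventSet A)ᶜ

/-- The subspace `ker(A - z)`. -/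
def eigenspace (A : H →ₗ.[ℂ] H) (z : ℂ) : Submodule ℂ H :=
  (LinearMap.ker (A.toFun - z • A.domain.subtype)).map A.domain.subtype

/-- The discrete spectrum of a self-adjoint operator: isolated points of the spectrum that are
eigenvalues of finite multiplicity (for self-adjoint operators the algebraic and the geometric
multiplicities coincide). -/
def discreteSpectrum (A : H →ₗ.[ℂ] H) : Set ℂ :=
  {z | z ∈ spectrum A ∧ (∃ δ > 0, ∀ w ∈ spectrum A, ‖w - z‖ < δ → w = z) ∧
    eigenspace A z ≠ ⊥ ∧ FiniteDimensional ℂ (eigenspace A z)}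

/-- The essential spectrum `σ(A) \ σ_d(A)`. -/
def essSpectrum (A : H →ₗ.[ℂ] H) : Set ℂ := spectrum A \ discreteSpectrum A

/-- `A` is bounded from below. -/
def BoundedBelow (A : H →ₗ.[ℂ] H) : Prop :=
  ∃ c : ℝ, ∀ x : A.domain, c * ‖(x : H)‖ ^ 2 ≤ (⟪(x : H), A x⟫_ℂ).re

/-- `m(0; A) = dim ker A`. -/
def mult0 (A : H →ₗ.[ℂ] H) : ℕ := Module.finrank ℂ (eigenspace A 0)

/-- `P(0; A)`, the orthogonal projection onto `ker A` (the kernel of a closed operator is closed,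
so that the closure changes nothing for self-adjoint `A`). -/
def kerProj (A : H →ₗ.[ℂ] H) : H →L[ℂ] H :=
  (eigenspace A 0).topologicalClosure.starProjection

/-! ### Trace class operators, trace, Fredholm determinant -/

/-- The index type of a fixed orthonormal basis of `H`. -/
def basisIndex (H : Type*) [NormedAddCommGroup H] [InnerProductSpace ℂ H] [CompleteSpace H] :
    Set H := (exists_hilbertBasis ℂ H).choose

/-- A fixed orthonormal basis of `H`. -/
def onb (H : Type*) [NormedAddCommGroup H] [InnerProductSpace ℂ H] [CompleteSpace H] :
    HilbertBasis (basisIndex H) ℂ H := (exists_hilbertBasis ℂ H).choose_spec.choose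

/-- `T` is trace class: `∑ ⟨e_i, |T| e_i⟩ < ∞` where `|T| = (T* T)^{1/2}`. -/
def IsTraceClass (T : H →L[ℂ] H) : Prop :=
  Summable fun i => (⟪onb H i, CFC.abs T (onb H i)⟫_ℂ).re

/-- The trace of a trace class operator. -/
def trace (T : H →L[ℂ] H) : ℂ := ∑' i, ⟪onb H i, T (onb H i)⟫_ℂ

open Classical in
/-- The Fredholm determinant of `K`, where `K - 1` is trace class:
`det K = ∑ₖ tr (Λᵏ (K - 1))`, where `tr (Λᵏ T)` is the sum of the principal `k × k` minors of the
matrix of `T` in an orthonormal basis. -/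
def fredholmDet (K : H →L[ℂ] H) : ℂ :=
  ∑' I : Finset (basisIndex H),
    Matrix.det (Matrix.of fun i j : I => ⟪onb H i, (K - 1) (onb H j)⟫_ℂ)

/-! ### The symmetrized perturbation determinant -/

/-- `(A - z)^{1/2}` for a self-adjoint `A` and `z` outside `[inf σ(A), ∞)`, with the principal
branch of the square root: the inverse of the bounded normal operator `((A - z)⁻¹)^{1/2}`, which is
given by the continuous functional calculus. -/
def sqrtShift (A : H →ₗ.[ℂ] H) (z : ℂ) : H →ₗ.[ℂ] H :=
  (((cfc (fun w : ℂ => w ^ (1 / 2 : ℂ)) (resolvent A z) : H →L[ℂ] H) : H →ₗ[ℂ] H).toPMap ⊤).inverse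

/-- The product `B R B` of an unbounded `B` and a bounded `R`, on its natural domain
`{f ∈ dom B | R (B f) ∈ dom B}`. -/
def sandwich (B : H →ₗ.[ℂ] H) (R : H →L[ℂ] H) : H →ₗ.[ℂ] H where
  domain := (B.domain.comap ((R : H →ₗ[ℂ] H) ∘ₗ B.toFun)).map B.domain.subtype
  toFun :=
    { toFun := fun f => B ⟨R (B ⟨f.1, by
          obtain ⟨x, -, hx⟩ := f.2; rw [← hx]; exact x.2⟩), by
          obtain ⟨f, x, hx, rfl⟩ := f; exact hx⟩
      map_add' := by
        intro f g
        rw [← LinearPMap.map_add]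
        congr 1
        apply Subtype.ext
        simp only [Submodule.coe_add]
        rw [← map_add, ← LinearPMap.map_add]
        rfl
      map_smul' := by
        intro c f
        simp only [RingHom.id_apply]
        rw [← LinearPMap.map_smul]
        congr 1
        apply Subtype.ext
        simp only [Submodule.coe_smul]
        rw [← map_smul, ← LinearPMap.map_smul]
        rfl }

/-- `K` is the closure of `(S₂ - z)^{1/2} (S₁ - z)⁻¹ (S₂ - z)^{1/2}`, as a bounded operator defined
on all of `H`. -/
def IsSymmProduct (S₁ S₂ : H →ₗ.[ℂ] H) (z : ℂ) (K : H →L[ℂ] H) : Prop :=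
  (sandwich (sqrtShift S₂ z) (resolvent S₁ z)).closure = (K : H →ₗ[ℂ] H).toPMap ⊤

/-- The determinant of the closure of `(S₂ - z)^{1/2} (S₁ - z)⁻¹ (S₂ - z)^{1/2}` is well-defined:
this closure is bounded on `H`, and differs from the identity by a trace class operator. -/
def SymmDetDefined (S₁ S₂ : H →ₗ.[ℂ] H) (z : ℂ) : Prop :=
  ∃ K : H →L[ℂ] H, IsSymmProduct S₁ S₂ z K ∧ IsTraceClass (K - 1)

open Classical in
/-- The symmetrized perturbation determinant
`det (closure of (S₂ - z)^{1/2} (S₁ - z)⁻¹ (S₂ - z)^{1/2})`. -/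
def symmDet (S₁ S₂ : H →ₗ.[ℂ] H) (z : ℂ) : ℂ :=
  if h : ∃ K : H →L[ℂ] H, IsSymmProduct S₁ S₂ z K then fredholmDet h.choose else 0

/-- The half-line `[inf (σ(S₁) ∪ σ(S₂)), ∞)`. -/
def spectralHalfLine (S₁ S₂ : H →ₗ.[ℂ] H) : Set ℂ :=
  (fun x : ℝ => (x : ℂ)) '' Ici (sInf (Complex.re '' (spectrum S₁ ∪ spectrum S₂)))

/-- `tr ((S₂ - z)⁻¹ (1 - P(0; S₂)) - (S₁ - z)⁻¹ (1 - P(0; S₁)))`. -/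
def redTrace (S₁ S₂ : H →ₗ.[ℂ] H) (z : ℂ) : ℂ :=
  trace (resolvent S₂ z * (1 - kerProj S₂) - resolvent S₁ z * (1 - kerProj S₁))

/-! ### The branch of the power and the contour -/

/-- The cut `R_θ = {t e^{iθ} | t ≥ 0}`. -/
def cutRay (θ : ℝ) : Set ℂ := {z | ∃ t : ℝ, 0 ≤ t ∧ z = t * Complex.exp (θ * Complex.I)}

/-- The logarithm with branch cut `R_θ`: its imaginary part lies in `(θ - 2π, θ]`. -/
def cutLog (θ : ℝ) (z : ℂ) : ℂ :=
  Complex.log (z * Complex.exp (-((θ - Real.pi : ℝ) * Complex.I))) +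
    (θ - Real.pi : ℝ) * Complex.I

/-- The power `z ^ w`, `z ≠ 0`, with branch cut `R_θ`. -/
def cutPow (θ : ℝ) (z w : ℂ) : ℂ := Complex.exp (w * cutLog θ z)

/-- The parameters of a contour that comes in from infinity above the positive real axis, crosses
that axis at `r`, dips under `0`, crosses the negative real axis at `-r` and again at `-a`, and goes
out to infinity below the positive real axis. The two ends are rays that make the angles `±φ` with
the positive real axis. -/
structure Contour where
  (a r κ η φ : ℝ)

namespace Contour

/-- The point `x + i y`. -/
def pt (x y : ℝ) : ℂ := ⟨x, y⟩

/-- The open region enclosed by the contour: the box around the negative spectrum, the corridor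
under `0`, and the part around the positive half-axis, between the two rays. -/
def inside (γ : Contour) : Set ℂ :=
  {z | (-γ.a < z.re ∧ z.re < -γ.r ∧ |z.im| < γ.η) ∨
    (-γ.r ≤ z.re ∧ z.re ≤ γ.r ∧ -γ.η < z.im ∧ z.im < -γ.κ) ∨
    (γ.r < z.re ∧ |z.im| < γ.η + (z.re - γ.r) * Real.tan γ.φ)}

/-- The contour is nondegenerate, it does not meet the cut `R_θ` (that is, the corner `-r + iη`
is to the left of `R_θ`), and it encloses all of `σ` but `0`. In particular `0` is outside. -/
structure Admissible (γ : Contour) (θ : ℝ) (σ : Set ℂ) : Prop where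
  r_pos : 0 < γ.r
  r_lt_a : γ.r < γ.a
  kappa_pos : 0 < γ.κ
  kappa_lt_eta : γ.κ < γ.η
  phi_nonneg : 0 ≤ γ.φ
  phi_lt : γ.φ < Real.pi / 2
  corner_left : -γ.r * Real.sin θ < γ.η * Real.cos θ
  encloses : σ \ {0} ⊆ γ.inside

/-- The integral of `f` over the straight segment from `p` to `q`. -/
def segIntegral (f : ℂ → ℂ) (p q : ℂ) : ℂ :=
  ∫ u in (0 : ℝ)..1, f (p + u * (q - p)) * (q - p)

/-- Integrability of `f` on the straight segment from `p` to `q`. -/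
def SegIntegrable (f : ℂ → ℂ) (p q : ℂ) : Prop :=
  IntervalIntegrable (fun u : ℝ => f (p + u * (q - p))) volume 0 1

/-- The integral of `f` over the ray from `p` to infinity in the direction `e^{iα}`. -/
def rayIntegral (f : ℂ → ℂ) (p : ℂ) (α : ℝ) : ℂ :=
  ∫ u in Ioi (0 : ℝ), f (p + u * Complex.exp (α * Complex.I)) * Complex.exp (α * Complex.I)

/-- Absolute integrability of `f` on the ray from `p` to infinity in the direction `e^{iα}`. -/
def RayIntegrable (f : ℂ → ℂ) (p : ℂ) (α : ℝ) : Prop :=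
  IntegrableOn (fun u : ℝ => f (p + u * Complex.exp (α * Complex.I))) (Ioi 0)

/-- The counterclockwise contour integral of `f`. -/
def integral (γ : Contour) (f : ℂ → ℂ) : ℂ :=
  -rayIntegral f (pt γ.r γ.η) γ.φ
    + segIntegral f (pt γ.r γ.η) (pt γ.r (-γ.κ))
    + segIntegral f (pt γ.r (-γ.κ)) (pt (-γ.r) (-γ.κ))
    + segIntegral f (pt (-γ.r) (-γ.κ)) (pt (-γ.r) γ.η)
    + segIntegral f (pt (-γ.r) γ.η) (pt (-γ.a) γ.η)
    + segIntegral f (pt (-γ.a) γ.η) (pt (-γ.a) (-γ.η))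
    + segIntegral f (pt (-γ.a) (-γ.η)) (pt γ.r (-γ.η))
    + rayIntegral f (pt γ.r (-γ.η)) (-γ.φ)

/-- The contour integral of `f` converges absolutely. -/
def Integrable (γ : Contour) (f : ℂ → ℂ) : Prop :=
  RayIntegrable f (pt γ.r γ.η) γ.φ
    ∧ SegIntegrable f (pt γ.r γ.η) (pt γ.r (-γ.κ))
    ∧ SegIntegrable f (pt γ.r (-γ.κ)) (pt (-γ.r) (-γ.κ))
    ∧ SegIntegrable f (pt (-γ.r) (-γ.κ)) (pt (-γ.r) γ.η)
    ∧ SegIntegrable f (pt (-γ.r) γ.η) (pt (-γ.a) γ.η)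
    ∧ SegIntegrable f (pt (-γ.a) γ.η) (pt (-γ.a) (-γ.η))
    ∧ SegIntegrable f (pt (-γ.a) (-γ.η)) (pt γ.r (-γ.η))
    ∧ RayIntegrable f (pt γ.r (-γ.η)) (-γ.φ)

end Contour

/-! ### The relative zeta function -/

/-- The integrand `z^{-s} tr ((S₂ - z)⁻¹ (1 - P(0; S₂)) - (S₁ - z)⁻¹ (1 - P(0; S₁)))`. -/
def zetaIntegrand (S₁ S₂ : H →ₗ.[ℂ] H) (θ : ℝ) (s z : ℂ) : ℂ :=
  cutPow θ z (-s) * redTrace S₁ S₂ z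

/-- The relative spectral zeta function `ζ(s; S₁, S₂)`. -/
def relZeta (S₁ S₂ : H →ₗ.[ℂ] H) (θ : ℝ) (γ : Contour) (s : ℂ) : ℂ :=
  -(2 * Real.pi * Complex.I)⁻¹ * γ.integral (zetaIntegrand S₁ S₂ θ s)

/-- The function `t ↦ t^{-s} (d/dt) ln ((e^{iθ} t)^{m(0; S₁) - m(0; S₂)} D(e^{iθ} t))`, where `D` is
the symmetrized perturbation determinant. -/
def cutIntegrand (S₁ S₂ : H →ₗ.[ℂ] H) (θ : ℝ) (s : ℂ) (t : ℝ) : ℂ :=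
  (t : ℂ) ^ (-s) *
    logDeriv (fun u : ℝ => (Complex.exp (θ * Complex.I) * u) ^ ((mult0 S₁ : ℤ) - (mult0 S₂ : ℤ)) *
      symmDet S₁ S₂ (Complex.exp (θ * Complex.I) * u)) t

end RelZeta

end

/-!
The reduced trace `F(z) = tr ((S₂ - z)⁻¹ (1 - P₂) - (S₁ - z)⁻¹ (1 - P₁))` is holomorphic on
`(ρ(S₁) ∩ ρ(S₂)) \ {0}`, which contains the closed exterior of the contour except `0`. Hence the
contour can be pulled onto the branch cut `R_θ`: it becomes the cut, traversed once on each side,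
where the two boundary values of `z^{-s}` differ by the factor `e^{2πis}`. There is no contribution
from infinity because `z^{-s} F(z) = O(|z|^{-1-(ε + Re s)})`, and none from `0` because
`z^{-s} F(z) = O(|z|^{-Re s})` with `Re s < 1`. On the cut the hypothesis on the determinant says
that `e^{iθ} F(e^{iθ} t)` is minus the logarithmic derivative of
`(e^{iθ} t)^{m(0; S₁) - m(0; S₂)} D(e^{iθ} t)`.

*Holomorphy of `F`.* The determinant is only controlled off the half-line `[inf σ, ∞)`, while the
contour crosses that half-line in gaps of the spectrum, so holomorphy has to come from the trace
itself. With `T` the resolvent difference at a fixed point `z₀`, the one at `z` is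
`(1 + (z - z₀) R₂(z)) T (1 + (z - z₀) R₁(z))` (`resolvent_sub_eq_mul`). A trace class `T` is a
product of two Hilbert–Schmidt operators (`IsTraceClass.exists_hilbertSchmidt_mul`), and cyclicity of the
trace then gives a locally uniformly dominated series
(`IsTraceClass.differentiableOn_trace_mul_mul`). Since `0` is not in the essential spectrum the
kernels are finite-dimensional, and removing them adds `(m(0; S₂) - m(0; S₁)) / z` (`redTrace_eq`).

*The deformation.* The exterior of the contour is divided into convex pieces, on each of which the
integrand, with a suitable branch of the power, has a primitive. There are two kinds of pieces:
unbounded regions between two rays (`Contour.rayIntegral_eq_add`) and triangles with the vertex `0`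
(`Contour.segIntegral_zero_add`). The branch cut along the negative half-axis serves on the right of
the cut, the one cut along the positive half-axis on the left. The pieces are added up in
`Contour.integral_powMul_eq_sub`.
-/

namespace RelZeta

section TraceClass

variable {H : Type*} [NormedAddCommGroup H] [InnerProductSpace ℂ H] [CompleteSpace H]

/-! ### Hilbert–Schmidt and trace class operators -/

/-- `T` is a Hilbert–Schmidt operator, expressed in the fixed orthonormal basis. -/
def IsHilbertSchmidt (T : H →L[ℂ] H) : Prop := Summable fun i => ‖T (onb H i)‖ ^ 2

lemma hasSum_norm_inner_sq (x : H) : HasSum (fun i => ‖⟪onb H i, x⟫_ℂ‖ ^ 2) (‖x‖ ^ 2) := by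
  have h := (onb H).hasSum_inner_mul_inner x x
  have e : ∀ i, ⟪x, onb H i⟫_ℂ * ⟪onb H i, x⟫_ℂ = ((‖⟪onb H i, x⟫_ℂ‖ ^ 2 : ℝ) : ℂ) := by
    intro i
    rw [← inner_conj_symm x (onb H i), RCLike.conj_mul]
    norm_cast
  have e2 : ⟪x, x⟫_ℂ = ((‖x‖ ^ 2 : ℝ) : ℂ) := by
    rw [inner_self_eq_norm_sq_to_K]
    norm_cast
  rw [e2] at h
  simp only [e] at h
  exact Complex.hasSum_ofReal.mp h

lemma IsHilbertSchmidt.summable_prod {T : H →L[ℂ] H} (hT : IsHilbertSchmidt T) :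
    Summable fun p : basisIndex H × basisIndex H => ‖⟪onb H p.2, T (onb H p.1)⟫_ℂ‖ ^ 2 := by
  rw [summable_prod_of_nonneg (fun _ => by positivity)]
  refine ⟨fun i => (hasSum_norm_inner_sq (T (onb H i))).summable, ?_⟩
  have : (fun i => ∑' j, ‖⟪onb H j, T (onb H i)⟫_ℂ‖ ^ 2) = fun i => ‖T (onb H i)‖ ^ 2 := by
    ext i
    exact (hasSum_norm_inner_sq (T (onb H i))).tsum_eq
  rw [this]
  exact hT

lemma IsHilbertSchmidt.adjoint {T : H →L[ℂ] H} (hT : IsHilbertSchmidt T) :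
    IsHilbertSchmidt (ContinuousLinearMap.adjoint T) := by
  have h := ((Equiv.prodComm _ _).summable_iff.mpr hT.summable_prod)
  rw [summable_prod_of_nonneg (fun _ => by simp only [Function.comp]; positivity)] at h
  refine h.2.congr fun i => ?_
  rw [← (hasSum_norm_inner_sq (ContinuousLinearMap.adjoint T (onb H i))).tsum_eq]
  refine tsum_congr fun j => ?_
  simp only [Function.comp, Equiv.prodComm_apply, Prod.swap]
  rw [ContinuousLinearMap.adjoint_inner_right, norm_inner_symm]

lemma IsHilbertSchmidt.mul_left {T : H →L[ℂ] H} (hT : IsHilbertSchmidt T) (A : H →L[ℂ] H) :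
    IsHilbertSchmidt (A * T) := by
  refine Summable.of_nonneg_of_le (fun _ => by positivity) (fun i => ?_)
    (Summable.mul_left (‖A‖ ^ 2) hT)
  rw [← mul_pow]
  gcongr
  exact A.le_opNorm _

lemma IsHilbertSchmidt.mul_right {T : H →L[ℂ] H} (hT : IsHilbertSchmidt T) (A : H →L[ℂ] H) :
    IsHilbertSchmidt (T * A) := by
  have h := (hT.adjoint.mul_left (ContinuousLinearMap.adjoint A)).adjoint
  rwa [← ContinuousLinearMap.star_eq_adjoint, ← ContinuousLinearMap.star_eq_adjoint,
    ← ContinuousLinearMap.star_eq_adjoint, ← star_mul, star_star] at h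

/-- The trace of a product of Hilbert–Schmidt operators is a double sum of products of matrix
entries that converges absolutely. -/
lemma IsHilbertSchmidt.summable_mul {X Y : H →L[ℂ] H} (hX : IsHilbertSchmidt X)
    (hY : IsHilbertSchmidt Y) :
    Summable fun p : basisIndex H × basisIndex H =>
      ⟪onb H p.1, X (onb H p.2)⟫_ℂ * ⟪onb H p.2, Y (onb H p.1)⟫_ℂ := by
  have h := ((Equiv.prodComm _ _).summable_iff.mpr hX.summable_prod).add hY.summable_prod
  refine Summable.of_norm_bounded h fun p => ?_
  rw [norm_mul]
  simp only [Function.comp, Equiv.prodComm_apply, Prod.swap]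
  nlinarith [sq_nonneg (‖⟪onb H p.1, X (onb H p.2)⟫_ℂ‖ - ‖⟪onb H p.2, Y (onb H p.1)⟫_ℂ‖),
    norm_nonneg ⟪onb H p.1, X (onb H p.2)⟫_ℂ, norm_nonneg ⟪onb H p.2, Y (onb H p.1)⟫_ℂ,
    mul_nonneg (norm_nonneg ⟪onb H p.1, X (onb H p.2)⟫_ℂ)
      (norm_nonneg ⟪onb H p.2, Y (onb H p.1)⟫_ℂ)]

lemma hasSum_inner_mul (X Y : H →L[ℂ] H) (x : H) :
    HasSum (fun j => ⟪x, X (onb H j)⟫_ℂ * ⟪onb H j, Y x⟫_ℂ) ⟪x, (X * Y) x⟫_ℂ := by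
  have h := (onb H).hasSum_inner_mul_inner (ContinuousLinearMap.adjoint X x) (Y x)
  simp only [ContinuousLinearMap.adjoint_inner_left] at h
  exact h

lemma IsHilbertSchmidt.hasSum_mul {X Y : H →L[ℂ] H} (hX : IsHilbertSchmidt X)
    (hY : IsHilbertSchmidt Y) :
    HasSum (fun i => ⟪onb H i, (X * Y) (onb H i)⟫_ℂ)
      (∑' p : basisIndex H × basisIndex H,
        ⟪onb H p.1, X (onb H p.2)⟫_ℂ * ⟪onb H p.2, Y (onb H p.1)⟫_ℂ) :=
  (hX.summable_mul hY).hasSum.prod_fiberwise fun i => hasSum_inner_mul X Y (onb H i)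

lemma IsHilbertSchmidt.trace_mul_comm {X Y : H →L[ℂ] H} (hX : IsHilbertSchmidt X)
    (hY : IsHilbertSchmidt Y) : trace (X * Y) = trace (Y * X) := by
  rw [trace, trace, (hX.hasSum_mul hY).tsum_eq, (hY.hasSum_mul hX).tsum_eq,
    ← (Equiv.prodComm _ _).tsum_eq]
  refine tsum_congr fun p => ?_
  simp only [Equiv.prodComm_apply, Prod.swap]
  rw [mul_comm]

lemma norm_abs_apply (T : H →L[ℂ] H) (x : H) : ‖CFC.abs T x‖ = ‖T x‖ := by
  have h1 : IsSelfAdjoint (CFC.abs T) := (CFC.abs_nonneg T).isSelfAdjoint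
  have h2 := CFC.abs_mul_abs T
  have h3 : ⟪CFC.abs T x, CFC.abs T x⟫_ℂ = ⟪T x, T x⟫_ℂ := by
    rw [← ContinuousLinearMap.adjoint_inner_right, ← ContinuousLinearMap.adjoint_inner_right T,
      ← ContinuousLinearMap.star_eq_adjoint, ← ContinuousLinearMap.star_eq_adjoint, h1.star_eq]
    exact congrArg (fun A : H →L[ℂ] H => ⟪x, A x⟫_ℂ) h2
  rw [inner_self_eq_norm_sq_to_K, inner_self_eq_norm_sq_to_K] at h3
  have h4 : ‖CFC.abs T x‖ ^ 2 = ‖T x‖ ^ 2 := by exact_mod_cast h3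
  exact (sq_eq_sq₀ (norm_nonneg _) (norm_nonneg _)).mp h4

/-- The polar decomposition, without the statement that `U` is a partial isometry. -/
lemma exists_mul_abs_eq (T : H →L[ℂ] H) : ∃ U : H →L[ℂ] H, U * CFC.abs T = T := by
  set A := CFC.abs T
  set K : Submodule ℂ H := (LinearMap.range (A : H →ₗ[ℂ] H)).topologicalClosure
  have hK : ∀ x, A x ∈ K := fun x =>
    Submodule.le_topologicalClosure _ (LinearMap.mem_range_self (A : H →ₗ[ℂ] H) x)
  set e : H →ₗ[ℂ] K := (A : H →ₗ[ℂ] H).codRestrict K hK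
  have : CompleteSpace K := (Submodule.isClosed_topologicalClosure _).completeSpace_coe
  have he : DenseRange e := by
    intro y
    rw [Topology.IsInducing.subtypeVal.closure_eq_preimage_closure_image]
    have : (Subtype.val '' Set.range e) = (LinearMap.range (A : H →ₗ[ℂ] H) : Set H) := by
      ext z
      constructor
      · rintro ⟨_, ⟨x, rfl⟩, rfl⟩
        exact ⟨x, rfl⟩
      · rintro ⟨x, rfl⟩
        exact ⟨e x, ⟨x, rfl⟩, rfl⟩
    rw [Set.mem_preimage]
    have hy : (y : H) ∈ closure (LinearMap.range (A : H →ₗ[ℂ] H) : Set H) := y.2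
    rwa [← this] at hy
  refine ⟨((T : H →ₗ[ℂ] H).extendOfNorm e).comp K.orthogonalProjectionOnto, ?_⟩
  ext x
  have h1 : K.orthogonalProjectionOnto (A x) = e x :=
    Submodule.orthogonalProjectionOnto_mem_subspace_eq_self (K := K) (e x)
  have h2 := LinearMap.extendOfNorm_eq (f := (T : H →ₗ[ℂ] H)) (e := e) he
    ⟨1, fun x => by
      rw [one_mul]
      exact (norm_abs_apply T x).symm.le⟩ x
  change (T : H →ₗ[ℂ] H).extendOfNorm e (K.orthogonalProjectionOnto (A x)) = T x
  rw [h1, h2]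
  rfl

/-- A trace class operator is a product of Hilbert–Schmidt operators. -/
lemma IsTraceClass.exists_hilbertSchmidt_mul {T : H →L[ℂ] H} (hT : IsTraceClass T) :
    ∃ X Y : H →L[ℂ] H, IsHilbertSchmidt X ∧ IsHilbertSchmidt Y ∧ T = X * Y := by
  obtain ⟨U, hU⟩ := exists_mul_abs_eq T
  set D := CFC.sqrt (CFC.abs T)
  have hDD : D * D = CFC.abs T := CFC.sqrt_mul_sqrt_self _ (CFC.abs_nonneg T)
  have hD : IsSelfAdjoint D := (CFC.sqrt_nonneg (CFC.abs T)).isSelfAdjoint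
  have hHS : IsHilbertSchmidt D := by
    refine Summable.congr hT fun i => ?_
    rw [← hDD, ← inner_self_eq_norm_sq (𝕜 := ℂ), ← ContinuousLinearMap.adjoint_inner_right,
      ← ContinuousLinearMap.star_eq_adjoint, hD.star_eq]
    rfl
  exact ⟨U * D, D, hHS.mul_left U, hHS, by rw [mul_assoc, hDD, hU]⟩

/-- If `A` and `B` depend holomorphically on a parameter and `T` is trace class, then so does
`tr (A T B)`. With `T = X Y` and `X`, `Y` Hilbert–Schmidt, cyclicity turns the trace into
`∑ ⟨Y* eᵢ, B A X eᵢ⟩`, which is dominated locally uniformly in the parameter. -/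
lemma IsTraceClass.differentiableOn_trace_mul_mul {T : H →L[ℂ] H} (hT : IsTraceClass T)
    {A B : ℂ → H →L[ℂ] H} {U : Set ℂ} (hU : IsOpen U) (hA : DifferentiableOn ℂ A U)
    (hB : DifferentiableOn ℂ B U) : DifferentiableOn ℂ (fun z => trace (A z * T * B z)) U := by
  obtain ⟨X, Y, hX, hY, rfl⟩ := hT.exists_hilbertSchmidt_mul
  have key : ∀ z, trace (A z * (X * Y) * B z) =
      ∑' i, ⟪ContinuousLinearMap.adjoint Y (onb H i), (B z * A z) (X (onb H i))⟫_ℂ := by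
    intro z
    have h := (hX.mul_left (A z)).trace_mul_comm (hY.mul_right (B z))
    rw [mul_assoc, mul_assoc, ← mul_assoc, h, trace]
    refine tsum_congr fun i => ?_
    rw [ContinuousLinearMap.adjoint_inner_left]
    rfl
  have hBA : DifferentiableOn ℂ (fun z => B z * A z) U := hB.mul hA
  intro z₀ hz₀
  have hc : ContinuousAt (fun z => B z * A z) z₀ := (hBA.continuousOn.continuousAt
    (hU.mem_nhds hz₀))
  have hev : ∀ᶠ z in 𝓝 z₀, ‖B z * A z‖ < ‖B z₀ * A z₀‖ + 1 :=
    hc.norm.eventually (gt_mem_nhds (lt_add_one _))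
  obtain ⟨V, hV, hVo, hz₀V⟩ := eventually_nhds_iff.mp (hev.and (hU.mem_nhds hz₀))
  have hsum : Summable fun i => (‖B z₀ * A z₀‖ + 1) *
      (‖ContinuousLinearMap.adjoint Y (onb H i)‖ ^ 2 + ‖X (onb H i)‖ ^ 2) :=
    (hY.adjoint.add hX).mul_left _
  have hd : DifferentiableOn ℂ (fun z => ∑' i,
      ⟪ContinuousLinearMap.adjoint Y (onb H i), (B z * A z) (X (onb H i))⟫_ℂ) V := by
    refine Complex.differentiableOn_tsum_of_summable_norm hsum (fun i => ?_) hVo fun i z hz => ?_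
    · have h1 : DifferentiableOn ℂ (fun z => (B z * A z) (X (onb H i))) V :=
        (hBA.mono fun z hz => (hV z hz).2).clm_apply (differentiableOn_const _)
      exact (innerSL ℂ
        (ContinuousLinearMap.adjoint Y (onb H i))).differentiable.comp_differentiableOn h1
    · refine (norm_inner_le_norm _ _).trans ?_
      have h1 : ‖(B z * A z) (X (onb H i))‖ ≤ (‖B z₀ * A z₀‖ + 1) * ‖X (onb H i)‖ :=
        ((B z * A z).le_opNorm _).trans (by gcongr; exact (hV z hz).1.le)
      calc _ ≤ ‖ContinuousLinearMap.adjoint Y (onb H i)‖ *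
            ((‖B z₀ * A z₀‖ + 1) * ‖X (onb H i)‖) := by gcongr
        _ = (‖B z₀ * A z₀‖ + 1) *
            (‖ContinuousLinearMap.adjoint Y (onb H i)‖ * ‖X (onb H i)‖) := by ring
        _ ≤ _ := by
          gcongr
          nlinarith [sq_nonneg (‖ContinuousLinearMap.adjoint Y (onb H i)‖ - ‖X (onb H i)‖),
            mul_nonneg (norm_nonneg (ContinuousLinearMap.adjoint Y (onb H i)))
              (norm_nonneg (X (onb H i)))]
  simp only [key]
  exact (hd.differentiableAt (hVo.mem_nhds hz₀V)).differentiableWithinAt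

/-- The diagonal of `A T B` is summable when `T` is trace class. -/
lemma IsTraceClass.summable_inner_mul_mul {T : H →L[ℂ] H} (hT : IsTraceClass T)
    (A B : H →L[ℂ] H) : Summable fun i => ⟪onb H i, (A * T * B) (onb H i)⟫_ℂ := by
  obtain ⟨X, Y, hX, hY, rfl⟩ := hT.exists_hilbertSchmidt_mul
  have h := ((hX.mul_left A).hasSum_mul (hY.mul_right B)).summable
  rwa [show A * X * (Y * B) = A * (X * Y) * B by simp only [mul_assoc]] at h

/-- The trace of an orthogonal projection of finite rank is its rank. -/
lemma hasSum_inner_starProjection (K : Submodule ℂ H) [FiniteDimensional ℂ K] :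
    HasSum (fun i => ⟪onb H i, K.starProjection (onb H i)⟫_ℂ) (Module.finrank ℂ K) := by
  have b := stdOrthonormalBasis ℂ K
  have h1 : ∀ k, HasSum (fun i => ⟪onb H i, (b k : H)⟫_ℂ * ⟪(b k : H), onb H i⟫_ℂ) 1 := by
    intro k
    have h := (onb H).hasSum_inner_mul_inner (b k : H) (b k : H)
    have h0 : ⟪(b k : H), (b k : H)⟫_ℂ = 1 := by
      have := b.orthonormal.1 k
      rw [inner_self_eq_norm_sq_to_K]
      have h' : ‖(b k : H)‖ = 1 := this
      simp [h']
    rw [h0] at h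
    simpa only [mul_comm] using h
  have h2 := hasSum_sum (s := Finset.univ) fun k _ => h1 k
  have h3 : ∀ i, ⟪onb H i, K.starProjection (onb H i)⟫_ℂ =
      ∑ k, ⟪onb H i, (b k : H)⟫_ℂ * ⟪(b k : H), onb H i⟫_ℂ := by
    intro i
    rw [Submodule.starProjection_apply, b.orthogonalProjectionOnto_apply_eq_sum]
    push_cast
    rw [inner_sum]
    refine Finset.sum_congr rfl fun k _ => ?_
    rw [inner_smul_right, mul_comm]
  simp only [h3]
  convert h2 using 1
  simp

end TraceClass

section Resolvent

variable {H : Type*} [NormedAddCommGroup H] [InnerProductSpace ℂ H]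

/-! ### Resolvents and kernels -/

lemma IsResolventAt.unique {A : H →ₗ.[ℂ] H} {z : ℂ} {R R' : H →L[ℂ] H}
    (h : IsResolventAt A z R) (h' : IsResolventAt A z R') : R = R' := by
  ext y
  obtain ⟨x, hx, hy⟩ := h.1 y
  rw [← hx, ← h'.2 x, hy]

lemma isResolventAt_resolvent {A : H →ₗ.[ℂ] H} {z : ℂ} (hz : z ∈ resolventSet A) :
    IsResolventAt A z (resolvent A z) := by
  have h : ∃ R : H →L[ℂ] H, IsResolventAt A z R := hz
  rw [resolvent, dif_pos h]
  exact h.choose_spec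

lemma IsResolventAt.resolvent_eq {A : H →ₗ.[ℂ] H} {z : ℂ} {R : H →L[ℂ] H}
    (h : IsResolventAt A z R) : resolvent A z = R :=
  (isResolventAt_resolvent ⟨R, h⟩).unique h

/-- The first resolvent identity. -/
lemma resolvent_sub_resolvent {A : H →ₗ.[ℂ] H} {z w : ℂ} (hz : z ∈ resolventSet A)
    (hw : w ∈ resolventSet A) :
    resolvent A z - resolvent A w = (z - w) • (resolvent A z * resolvent A w) := by
  ext y
  obtain ⟨x, hx, hy⟩ := (isResolventAt_resolvent hw).1 y
  have h := (isResolventAt_resolvent hz).2 x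
  have e : A x - z • (x : H) = y - (z - w) • (x : H) := by rw [← hy]; module
  rw [e, map_sub, map_smul, sub_eq_iff_eq_add] at h
  simp only [sub_apply, smul_apply,
    mul_apply_eq_comp]
  rw [← hx, h]
  module

/-- The resolvent difference at `z` in terms of the one at `z₀`. -/
lemma resolvent_sub_eq_mul {S₁ S₂ : H →ₗ.[ℂ] H} {z z₀ : ℂ}
    (hz : z ∈ resolventSet S₁ ∩ resolventSet S₂) (hz₀ : z₀ ∈ resolventSet S₁ ∩ resolventSet S₂) :
    resolvent S₂ z - resolvent S₁ z = (1 + (z - z₀) • resolvent S₂ z) *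
      (resolvent S₂ z₀ - resolvent S₁ z₀) * (1 + (z - z₀) • resolvent S₁ z) := by
  have h2 : (1 + (z - z₀) • resolvent S₂ z) * resolvent S₂ z₀ = resolvent S₂ z := by
    rw [add_mul, one_mul, smul_mul_assoc, ← resolvent_sub_resolvent hz.2 hz₀.2]
    abel
  have h1 : resolvent S₁ z₀ * (1 + (z - z₀) • resolvent S₁ z) = resolvent S₁ z := by
    have h := resolvent_sub_resolvent hz₀.1 hz.1
    rw [mul_add, mul_one, mul_smul_comm, ← neg_sub z₀ z, neg_smul, ← h]
    abel
  rw [mul_sub, sub_mul, h2, mul_assoc, h1, mul_add, add_mul, mul_one, one_mul, mul_smul_comm,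
    smul_mul_assoc]
  abel

/-- The Neumann series gives the resolvent near a point of the resolvent set. -/
lemma IsResolventAt.of_isUnit {A : H →ₗ.[ℂ] H} {z₀ z : ℂ} {R : H →L[ℂ] H}
    (h : IsResolventAt A z₀ R) (hu : IsUnit (1 - (z - z₀) • R)) :
    IsResolventAt A z (R * Ring.inverse (1 - (z - z₀) • R)) := by
  set N := 1 - (z - z₀) • R
  have hN1 : ∀ y, N (Ring.inverse N y) = y := fun y =>
    congrArg (fun B : H →L[ℂ] H => B y) (Ring.mul_inverse_cancel N hu)
  have hN2 : ∀ y, Ring.inverse N (N y) = y := fun y =>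
    congrArg (fun B : H →L[ℂ] H => B y) (Ring.inverse_mul_cancel N hu)
  have hN : ∀ y, N y = y - (z - z₀) • R y := fun y => by simp [N]
  constructor
  · intro y
    obtain ⟨x, hx, hy⟩ := h.1 (Ring.inverse N y)
    refine ⟨x, hx, ?_⟩
    have h1 := hN1 y
    rw [hN, ← hx, ← hy] at h1
    rw [← h1]
    module
  · intro x
    have h1 : A x - z • (x : H) = N (A x - z₀ • (x : H)) := by
      rw [hN, h.2 x]
      module
    rw [h1, mul_apply_eq_comp, hN2, h.2 x]

lemma finiteDimensional_eigenspace_zero {A : H →ₗ.[ℂ] H} (h : (0 : ℂ) ∉ essSpectrum A) :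
    FiniteDimensional ℂ (eigenspace A 0) := by
  by_cases h0 : (0 : ℂ) ∈ spectrum A
  · by_contra hf
    exact h ⟨h0, fun hd => hf hd.2.2.2⟩
  · have h0' : (0 : ℂ) ∈ resolventSet A := not_not.mp h0
    have hbot : eigenspace A 0 = ⊥ := by
      rw [eq_bot_iff]
      rintro _ ⟨x, hx, rfl⟩
      have h1 : A x - (0 : ℂ) • (x : H) = 0 := hx
      have h2 := (isResolventAt_resolvent h0').2 x
      rw [h1, map_zero] at h2
      exact h2.symm
    rw [hbot]
    infer_instance

lemma zero_notMem_essSpectrum {A : H →ₗ.[ℂ] H} {l : ℝ} (hl : 0 < l)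
    (h : essSpectrum A ⊆ (fun x : ℝ => (x : ℂ)) '' Ici l) : (0 : ℂ) ∉ essSpectrum A := by
  intro h0
  obtain ⟨x, hx, hx0⟩ := h h0
  have : x = 0 := Complex.ofReal_eq_zero.mp hx0
  exact absurd (this ▸ hx : l ≤ 0) (not_le.mpr hl)

variable [CompleteSpace H]

lemma eventually_isUnit_one_sub_smul (z₀ : ℂ) (R : H →L[ℂ] H) :
    ∀ᶠ z in 𝓝 z₀, IsUnit (1 - (z - z₀) • R) := by
  have hc : Continuous fun z : ℂ => 1 - (z - z₀) • R := by fun_prop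
  exact hc.continuousAt.eventually (Units.isOpen.mem_nhds (by simp))

lemma isOpen_resolventSet (A : H →ₗ.[ℂ] H) : IsOpen (resolventSet A) := by
  rw [isOpen_iff_mem_nhds]
  rintro z₀ ⟨R, hR⟩
  filter_upwards [eventually_isUnit_one_sub_smul z₀ R] with z hz
  exact ⟨_, hR.of_isUnit hz⟩

lemma differentiableOn_resolvent (A : H →ₗ.[ℂ] H) :
    DifferentiableOn ℂ (resolvent A) (resolventSet A) := by
  rintro z₀ ⟨R, hR⟩
  refine DifferentiableAt.differentiableWithinAt ?_
  have h : DifferentiableAt ℂ (fun z => R * Ring.inverse (1 - (z - z₀) • R)) z₀ := by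
    refine DifferentiableAt.const_mul ?_ _
    have h1 : DifferentiableAt ℂ (fun z : ℂ => 1 - (z - z₀) • R) z₀ := by fun_prop
    exact (differentiableAt_inverse (𝕜 := ℂ) (x := 1 - (z₀ - z₀) • R) (by simp)).comp z₀ h1
  refine h.congr_of_eventuallyEq ?_
  filter_upwards [eventually_isUnit_one_sub_smul z₀ R] with z hz
  exact (hR.of_isUnit hz).resolvent_eq

lemma kerProj_eq (A : H →ₗ.[ℂ] H) [FiniteDimensional ℂ (eigenspace A 0)] :
    kerProj A = (eigenspace A 0).starProjection := by
  have h : (eigenspace A 0).topologicalClosure = eigenspace A 0 :=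
    (Submodule.closed_of_finiteDimensional _).submodule_topologicalClosure_eq
  ext x
  rw [kerProj]
  congr! 2

/-- On the kernel of `A` the resolvent at `z` is multiplication by `-1 / z`. -/
lemma resolvent_mul_kerProj {A : H →ₗ.[ℂ] H} [FiniteDimensional ℂ (eigenspace A 0)] {z : ℂ}
    (hz : z ∈ resolventSet A) (hz0 : z ≠ 0) :
    resolvent A z * kerProj A = -z⁻¹ • kerProj A := by
  ext y
  rw [kerProj_eq]
  obtain ⟨x, hx, hxy⟩ : (eigenspace A 0).starProjection y ∈ eigenspace A 0 :=
    Submodule.starProjection_apply_mem _ _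
  have h1 : A x - (0 : ℂ) • (x : H) = 0 := hx
  have h2 := (isResolventAt_resolvent hz).2 x
  rw [zero_smul, sub_zero] at h1
  rw [h1, zero_sub, map_neg, map_smul] at h2
  have hxy' : (x : H) = (eigenspace A 0).starProjection y := hxy
  rw [mul_apply_eq_comp, smul_apply, ← hxy']
  nth_rewrite 2 [← h2]
  rw [smul_neg, neg_smul, neg_neg, smul_smul, inv_mul_cancel₀ hz0, one_smul]

/-! ### The reduced trace -/

/-- Removing the kernels changes the trace of the resolvent difference by a multiple of `1 / z`. -/
lemma redTrace_eq {S₁ S₂ : H →ₗ.[ℂ] H} [FiniteDimensional ℂ (eigenspace S₁ 0)]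
    [FiniteDimensional ℂ (eigenspace S₂ 0)]
    (htc : ∃ z ∈ resolventSet S₁ ∩ resolventSet S₂, IsTraceClass (resolvent S₂ z - resolvent S₁ z))
    {z : ℂ} (hz : z ∈ resolventSet S₁ ∩ resolventSet S₂) (hz0 : z ≠ 0) :
    redTrace S₁ S₂ z =
      trace (resolvent S₂ z - resolvent S₁ z) + ((mult0 S₂ : ℂ) - mult0 S₁) * z⁻¹ := by
  obtain ⟨z₀, hz₀, hT⟩ := htc
  have hs : HasSum (fun i => ⟪onb H i, (resolvent S₂ z - resolvent S₁ z) (onb H i)⟫_ℂ)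
      (trace (resolvent S₂ z - resolvent S₁ z)) := by
    have h := hT.summable_inner_mul_mul (1 + (z - z₀) • resolvent S₂ z)
      (1 + (z - z₀) • resolvent S₁ z)
    rw [← resolvent_sub_eq_mul hz hz₀] at h
    exact h.hasSum
  have h1 := hasSum_inner_starProjection (eigenspace S₁ 0)
  have h2 := hasSum_inner_starProjection (eigenspace S₂ 0)
  have e : resolvent S₂ z * (1 - kerProj S₂) - resolvent S₁ z * (1 - kerProj S₁) =
      (resolvent S₂ z - resolvent S₁ z) +
        z⁻¹ • ((eigenspace S₂ 0).starProjection - (eigenspace S₁ 0).starProjection) := by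
    rw [mul_sub, mul_sub, mul_one, mul_one, resolvent_mul_kerProj hz.1 hz0,
      resolvent_mul_kerProj hz.2 hz0, kerProj_eq, kerProj_eq]
    module
  rw [redTrace, e, trace]
  refine HasSum.tsum_eq ?_
  refine (hs.add ((h2.sub h1).mul_right z⁻¹)).congr_fun fun i => ?_
  rw [add_apply, smul_apply, sub_apply, sub_apply, inner_add_right, inner_smul_right,
    inner_sub_right, inner_sub_right, mul_comm z⁻¹]

lemma differentiableOn_redTrace {S₁ S₂ : H →ₗ.[ℂ] H} [FiniteDimensional ℂ (eigenspace S₁ 0)]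
    [FiniteDimensional ℂ (eigenspace S₂ 0)]
    (htc : ∃ z ∈ resolventSet S₁ ∩ resolventSet S₂,
      IsTraceClass (resolvent S₂ z - resolvent S₁ z)) :
    DifferentiableOn ℂ (redTrace S₁ S₂) ((resolventSet S₁ ∩ resolventSet S₂) \ {0}) := by
  have h0 : DifferentiableOn ℂ (fun z => trace (resolvent S₂ z - resolvent S₁ z))
      (resolventSet S₁ ∩ resolventSet S₂) := by
    obtain ⟨z₀, hz₀, hT⟩ := htc
    refine (hT.differentiableOn_trace_mul_mul
      (A := fun z => 1 + (z - z₀) • resolvent S₂ z) (B := fun z => 1 + (z - z₀) • resolvent S₁ z)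
      ((isOpen_resolventSet S₁).inter (isOpen_resolventSet S₂)) ?_ ?_).congr
      fun z hz => by rw [resolvent_sub_eq_mul hz hz₀]
    · exact (((differentiable_id.sub_const z₀).differentiableOn).smul
        ((differentiableOn_resolvent S₂).mono inter_subset_right)).const_add 1
    · exact (((differentiable_id.sub_const z₀).differentiableOn).smul
        ((differentiableOn_resolvent S₁).mono inter_subset_left)).const_add 1
  have h1 : DifferentiableOn ℂ
      (fun z : ℂ => ((mult0 S₂ : ℂ) - mult0 S₁) * z⁻¹)
      ((resolventSet S₁ ∩ resolventSet S₂) \ {0}) :=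
    (differentiableOn_inv.mono fun z hz => hz.2).const_mul _
  exact ((h0.mono sdiff_subset).add h1).congr fun z hz => redTrace_eq htc hz.1 hz.2

/-- On a ray `{c u | u > 0}` that avoids the half-line, the logarithmic derivative of the corrected
determinant is minus the reduced trace. -/
lemma logDeriv_zpow_mul_symmDet {S₁ S₂ : H →ₗ.[ℂ] H} [FiniteDimensional ℂ (eigenspace S₁ 0)]
    [FiniteDimensional ℂ (eigenspace S₂ 0)]
    (htc : ∃ z ∈ resolventSet S₁ ∩ resolventSet S₂, IsTraceClass (resolvent S₂ z - resolvent S₁ z))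
    {c : ℂ} {t : ℝ} (hct : c * t ≠ 0) (hz : c * t ∈ resolventSet S₁ ∩ resolventSet S₂)
    (hne : symmDet S₁ S₂ (c * t) ≠ 0) (hd : DifferentiableAt ℂ (symmDet S₁ S₂) (c * t))
    (htr : trace (resolvent S₂ (c * t) - resolvent S₁ (c * t)) =
      -logDeriv (symmDet S₁ S₂) (c * t)) :
    logDeriv (fun u : ℝ => (c * u) ^ ((mult0 S₁ : ℤ) - (mult0 S₂ : ℤ)) * symmDet S₁ S₂ (c * u)) t =
      -(c * redTrace S₁ S₂ (c * t)) := by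
  set n : ℤ := (mult0 S₁ : ℤ) - (mult0 S₂ : ℤ)
  set D := symmDet S₁ S₂
  have hc : HasDerivAt (fun u : ℂ => c * u) c (t : ℂ) := by
    simpa using (hasDerivAt_id (t : ℂ)).const_mul c
  have hG : HasDerivAt (fun z => z ^ n * D z)
      (n * (c * t) ^ (n - 1) * D (c * t) + (c * t) ^ n * deriv D (c * t)) (c * t) :=
    (hasDerivAt_zpow n _ (Or.inl hct)).mul hd.hasDerivAt
  have hder := (HasDerivAt.comp (t : ℂ) (h₂ := fun z => z ^ n * D z) hG hc).comp_ofReal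
  have hder' : HasDerivAt (fun u : ℝ => (c * u) ^ n * D (c * u))
      ((n * (c * t) ^ (n - 1) * D (c * t) + (c * t) ^ n * deriv D (c * t)) * c) t := hder
  rw [logDeriv_apply, hder'.deriv, redTrace_eq htc hz hct, htr, logDeriv_apply,
    zpow_sub_one₀ hct]
  have hn : (n : ℂ) = mult0 S₁ - mult0 S₂ := by simp [n]
  have hzn : (c * t) ^ n ≠ 0 := zpow_ne_zero _ hct
  rw [hn]
  generalize (c * (t : ℂ)) ^ n = Z at *
  generalize D (c * t) = d at *
  generalize c * (t : ℂ) = w at *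
  field_simp
  ring

end Resolvent

namespace Contour

/-! ### Integrals of holomorphic functions over segments and rays -/

lemma integral_line_eq_sub {W : Set ℂ} {f P : ℂ → ℂ} (hf : ContinuousOn f W)
    (hP : ∀ z ∈ W, HasDerivWithinAt P (f z) W z) {p v : ℂ} {a b : ℝ} (hab : a ≤ b)
    (h : ∀ u ∈ Icc a b, p + (u : ℝ) * v ∈ W) :
    ∫ u in a..b, f (p + u * v) * v = P (p + b * v) - P (p + a * v) := by
  have hl : ∀ u : ℝ, HasDerivAt (fun u : ℝ => p + u * v) v u := fun u => by
    simpa using ((hasDerivAt_id u).ofReal_comp.mul_const v).const_add p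
  have hd : ∀ u ∈ Icc a b,
      HasDerivWithinAt (fun u : ℝ => P (p + u * v)) (f (p + u * v) * v) (Icc a b) u := by
    intro u hu
    have := HasDerivWithinAt.scomp u (hP _ (h u hu)) (hl u).hasDerivWithinAt
      (s := Icc a b) (fun x hx => h x hx)
    simpa [mul_comm, Function.comp_def] using this
  refine intervalIntegral.integral_eq_sub_of_hasDerivAt_of_le hab
    (fun u hu => (hd u hu).continuousWithinAt)
    (fun u hu => (hd u (Ioo_subset_Icc_self hu)).hasDerivAt (Icc_mem_nhds hu.1 hu.2)) ?_
  refine ContinuousOn.intervalIntegrable ?_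
  rw [uIcc_of_le hab]
  exact (hf.comp (by fun_prop) h).mul continuousOn_const

lemma add_mul_sub_mem {W : Set ℂ} (hW : Convex ℝ W) {p q : ℂ} (hp : p ∈ W) (hq : q ∈ W) {u : ℝ}
    (hu : u ∈ Icc (0 : ℝ) 1) : p + u * (q - p) ∈ W := by
  have := hW.add_smul_sub_mem hp hq hu
  simpa [Complex.real_smul] using this

lemma segIntegral_eq_sub {W : Set ℂ} {f P : ℂ → ℂ} (hW : Convex ℝ W) (hf : ContinuousOn f W)
    (hP : ∀ z ∈ W, HasDerivWithinAt P (f z) W z) {p q : ℂ} (hp : p ∈ W) (hq : q ∈ W) :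
    segIntegral f p q = P q - P p := by
  have := integral_line_eq_sub hf hP zero_le_one (fun u hu => add_mul_sub_mem hW hp hq hu)
  rw [segIntegral, this]
  simp

lemma segIntegrable_of_continuousOn {W : Set ℂ} {f : ℂ → ℂ} (hW : Convex ℝ W)
    (hf : ContinuousOn f W) {p q : ℂ} (hp : p ∈ W) (hq : q ∈ W) : SegIntegrable f p q := by
  refine ContinuousOn.intervalIntegrable ?_
  rw [uIcc_of_le zero_le_one]
  exact hf.comp (by fun_prop) fun u hu => add_mul_sub_mem hW hp hq hu

lemma segIntegral_add {W : Set ℂ} {f : ℂ → ℂ} (hW : Convex ℝ W) (hf : DifferentiableOn ℂ f W)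
    {p q r : ℂ} (hp : p ∈ W) (hq : q ∈ W) (hr : r ∈ W) :
    segIntegral f p q + segIntegral f q r = segIntegral f p r := by
  obtain ⟨P, hP⟩ := hW.exists_forall_hasDerivWithinAt hf
  rw [segIntegral_eq_sub hW hf.continuousOn hP hp hq,
    segIntegral_eq_sub hW hf.continuousOn hP hq hr, segIntegral_eq_sub hW hf.continuousOn hP hp hr]
  ring

lemma segIntegral_congr {f g : ℂ → ℂ} {p q : ℂ}
    (h : ∀ u ∈ Ioo (0 : ℝ) 1, f (p + u * (q - p)) = g (p + u * (q - p))) :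
    segIntegral f p q = segIntegral g p q := by
  rw [segIntegral, segIntegral, intervalIntegral.integral_of_le zero_le_one,
    intervalIntegral.integral_of_le zero_le_one, integral_Ioc_eq_integral_Ioo,
    integral_Ioc_eq_integral_Ioo]
  exact setIntegral_congr_fun measurableSet_Ioo fun u hu => by simp only [h u hu]

lemma rayIntegral_congr {f g : ℂ → ℂ} {p : ℂ} {α : ℝ}
    (h : ∀ u ∈ Ioi (0 : ℝ),
      f (p + u * Complex.exp (α * Complex.I)) = g (p + u * Complex.exp (α * Complex.I))) :
    rayIntegral f p α = rayIntegral g p α :=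
  setIntegral_congr_fun measurableSet_Ioi fun u hu => by simp only [h u hu]

lemma RayIntegrable.congr {f g : ℂ → ℂ} {p : ℂ} {α : ℝ} (hf : RayIntegrable f p α)
    (h : ∀ u ∈ Ioi (0 : ℝ),
      f (p + u * Complex.exp (α * Complex.I)) = g (p + u * Complex.exp (α * Complex.I))) :
    RayIntegrable g p α :=
  IntegrableOn.congr_fun hf h measurableSet_Ioi

lemma segIntegral_swap (f : ℂ → ℂ) (p q : ℂ) : segIntegral f p q = -segIntegral f q p := by
  have h := intervalIntegral.integral_comp_sub_left
    (fun u : ℝ => f (q + u * (p - q)) * (q - p)) (a := 0) (b := 1) 1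
  have e : ∀ u : ℝ, q + ((1 - u : ℝ) : ℂ) * (p - q) = p + u * (q - p) := fun u => by
    push_cast
    ring
  simp only [e, sub_zero, sub_self] at h
  rw [segIntegral, h, segIntegral, ← intervalIntegral.integral_neg]
  refine intervalIntegral.integral_congr fun u _ => ?_
  ring

/-- A function with decay `O(|z|^{-1-δ})` on `W`. -/
def DecaysOn (f : ℂ → ℂ) (W : Set ℂ) (δ : ℝ) : Prop :=
  ∃ C R : ℝ, ∀ z ∈ W, R ≤ ‖z‖ → ‖f z‖ ≤ C * ‖z‖ ^ (-1 - δ)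

lemma DecaysOn.mono {f : ℂ → ℂ} {W W' : Set ℂ} {δ : ℝ} (h : DecaysOn f W δ) (hW : W' ⊆ W) :
    DecaysOn f W' δ := by
  obtain ⟨C, R, h⟩ := h
  exact ⟨C, R, fun z hz => h z (hW hz)⟩

lemma norm_add_mul_exp_ge (p : ℂ) (α : ℝ) {u : ℝ} (hu : 0 ≤ u) :
    u - ‖p‖ ≤ ‖p + u * Complex.exp (α * Complex.I)‖ := by
  have h := norm_sub_norm_le (u * Complex.exp (α * Complex.I)) (-p)
  rw [norm_mul, Complex.norm_exp_ofReal_mul_I, norm_neg, Complex.norm_real, Real.norm_of_nonneg hu,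
    mul_one, sub_neg_eq_add, add_comm _ p] at h
  exact h

lemma rayIntegrable_of_decaysOn {W : Set ℂ} {f : ℂ → ℂ} {p : ℂ} {α δ : ℝ} (hδ : 0 < δ)
    (hf : ContinuousOn f W) (hd : DecaysOn f W δ)
    (hp : ∀ u : ℝ, 0 ≤ u → p + u * Complex.exp (α * Complex.I) ∈ W) : RayIntegrable f p α := by
  obtain ⟨C, R, hd⟩ := hd
  have hc : ContinuousOn (fun u : ℝ => f (p + u * Complex.exp (α * Complex.I))) (Ici 0) :=
    hf.comp (by fun_prop) hp
  have hl := hc.locallyIntegrableOn measurableSet_Ici (μ := volume)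
  refine (hl.integrableOn_of_isBigO_atTop (g := fun u : ℝ => u ^ (-1 - δ)) ?_ ?_).mono_set
    Ioi_subset_Ici_self
  · refine IsBigO.of_bound (|C| * (1 / 2) ^ (-1 - δ)) ?_
    filter_upwards [eventually_ge_atTop 1, eventually_ge_atTop (2 * ‖p‖),
      eventually_ge_atTop (2 * R)] with u hu1 hu2 hu3
    have hu0 : 0 ≤ u := zero_le_one.trans hu1
    have hz := norm_add_mul_exp_ge p α hu0
    have hz2 : 1 / 2 * u ≤ ‖p + u * Complex.exp (α * Complex.I)‖ := by linarith
    refine (hd _ (hp u hu0) (by linarith)).trans ?_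
    rw [Real.norm_of_nonneg (by positivity), mul_assoc, ← Real.mul_rpow (by norm_num) hu0]
    refine mul_le_mul (le_abs_self C) ?_ (by positivity) (abs_nonneg C)
    exact Real.rpow_le_rpow_of_nonpos (by positivity) hz2 (by linarith)
  · exact integrableAtFilter_rpow_atTop_iff.mpr (by linarith)

lemma abs_re_im_le (a b : ℝ) (z : ℂ) : a * z.re + b * z.im ≤ (|a| + |b|) * ‖z‖ := by
  have h1 : a * z.re ≤ |a| * ‖z‖ := by
    refine (le_abs_self _).trans ?_
    rw [abs_mul]
    gcongr
    exact Complex.abs_re_le_norm z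
  have h2 : b * z.im ≤ |b| * ‖z‖ := by
    refine (le_abs_self _).trans ?_
    rw [abs_mul]
    gcongr
    exact Complex.abs_im_le_norm z
  linarith

/-- If `P` is a primitive of `f` in a convex set, then the increment of `P` along a segment
is at most the length times the supremum of `|f|`. -/
lemma norm_primitive_sub_le {W : Set ℂ} {f P : ℂ → ℂ} (hW : Convex ℝ W)
    (hP : ∀ z ∈ W, HasDerivWithinAt P (f z) W z) {p q : ℂ} (hp : p ∈ W) (hq : q ∈ W) {M : ℝ}
    (hM : ∀ z ∈ segment ℝ p q, ‖f z‖ ≤ M) : ‖P q - P p‖ ≤ M * ‖q - p‖ := by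
  have hs : segment ℝ p q ⊆ W := hW.segment_subset hp hq
  exact (convex_segment p q).norm_image_sub_le_of_norm_hasDerivWithin_le
    (fun z hz => (hP z (hs hz)).mono hs) hM (left_mem_segment ℝ p q) (right_mem_segment ℝ p q)

lemma le_of_mem_segment {a b m : ℝ} {p q z : ℂ} (hz : z ∈ segment ℝ p q)
    (hp : m ≤ a * p.re + b * p.im) (hq : m ≤ a * q.re + b * q.im) :
    m ≤ a * z.re + b * z.im := by
  obtain ⟨x, y, hx, hy, hxy, rfl⟩ := hz
  simp only [Complex.add_re, Complex.add_im, Complex.real_smul, Complex.re_ofReal_mul,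
    Complex.im_ofReal_mul]
  have := add_le_add (mul_le_mul_of_nonneg_left hp hx) (mul_le_mul_of_nonneg_left hq hy)
  rw [← add_mul, hxy, one_mul] at this
  linarith

/-- Cauchy's theorem for an unbounded convex region between two rays whose directions lie in a
common open half-plane. The segment that joins the points at distance `N` on the two rays
contributes `O(N · N^{-1-δ})`. -/
lemma rayIntegral_eq_add {W : Set ℂ} {f : ℂ → ℂ} {p q : ℂ} {α β δ a b : ℝ} (hδ : 0 < δ)
    (hW : Convex ℝ W) (hf : DifferentiableOn ℂ f W) (hd : DecaysOn f W δ)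
    (hp : ∀ u : ℝ, 0 ≤ u → p + u * Complex.exp (α * Complex.I) ∈ W)
    (hq : ∀ u : ℝ, 0 ≤ u → q + u * Complex.exp (β * Complex.I) ∈ W)
    (hα : 0 < a * Real.cos α + b * Real.sin α) (hβ : 0 < a * Real.cos β + b * Real.sin β) :
    rayIntegral f p α = segIntegral f p q + rayIntegral f q β := by
  obtain ⟨P, hP⟩ := hW.exists_forall_hasDerivWithinAt hf
  have hp0 : p ∈ W := by simpa using hp 0 le_rfl
  have hq0 : q ∈ W := by simpa using hq 0 le_rfl
  have hray : ∀ (p : ℂ) (α : ℝ), (∀ u : ℝ, 0 ≤ u → p + u * Complex.exp (α * Complex.I) ∈ W) →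
      Tendsto (fun N : ℝ => P (p + N * Complex.exp (α * Complex.I)) - P p) atTop
        (𝓝 (rayIntegral f p α)) := by
    intro p α hp
    have h1 := intervalIntegral_tendsto_integral_Ioi 0
      ((rayIntegrable_of_decaysOn hδ hf.continuousOn hd hp).mul_const
        (Complex.exp (α * Complex.I))) tendsto_id
    refine h1.congr' ?_
    filter_upwards [eventually_ge_atTop 0] with N hN
    have := integral_line_eq_sub hf.continuousOn hP (p := p) (v := Complex.exp (α * Complex.I)) hN
      fun u hu => hp u hu.1
    simpa using this
  have hfar : Tendsto (fun N : ℝ => P (q + N * Complex.exp (β * Complex.I)) -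
      P (p + N * Complex.exp (α * Complex.I))) atTop (𝓝 0) := by
    obtain ⟨C, R, hd⟩ := hd
    set m := min (a * Real.cos α + b * Real.sin α) (a * Real.cos β + b * Real.sin β)
    have hm : 0 < m := lt_min hα hβ
    set A := |a| + |b| + 1
    have hA : 0 < A := by positivity
    set c := m / (2 * A)
    have hc : 0 < c := by positivity
    set K := |a * p.re + b * p.im| + |a * q.re + b * q.im|
    have hzero : Tendsto (fun N : ℝ => |C| * c ^ (-1 - δ) * (‖q - p‖ + 2) * N ^ (-δ)) atTop
        (𝓝 0) := by
      simpa using (tendsto_rpow_neg_atTop hδ).const_mul (|C| * c ^ (-1 - δ) * (‖q - p‖ + 2))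
    refine squeeze_zero_norm' ?_ hzero
    filter_upwards [eventually_ge_atTop 1, eventually_ge_atTop (2 * K / m),
      eventually_ge_atTop (R / c)] with N hN1 hN2 hN3
    have hN0 : 0 < N := zero_lt_one.trans_le hN1
    have hK : 2 * K ≤ N * m := (div_le_iff₀ hm).mp hN2
    have hR : R ≤ N * c := (div_le_iff₀ hc).mp hN3
    have hlow : ∀ (p : ℂ) (α : ℝ), |a * p.re + b * p.im| ≤ K →
        m ≤ a * Real.cos α + b * Real.sin α →
        N * m / 2 ≤ a * (p + N * Complex.exp (α * Complex.I)).re +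
          b * (p + N * Complex.exp (α * Complex.I)).im := by
      intro p α hpK hmα
      simp only [Complex.add_re, Complex.add_im, Complex.re_ofReal_mul, Complex.im_ofReal_mul,
        Complex.exp_ofReal_mul_I_re, Complex.exp_ofReal_mul_I_im]
      have h1 := mul_le_mul_of_nonneg_left hmα hN0.le
      have h2 := neg_abs_le (a * p.re + b * p.im)
      linarith
    have hM : ∀ z ∈ segment ℝ (p + N * Complex.exp (α * Complex.I))
        (q + N * Complex.exp (β * Complex.I)), ‖f z‖ ≤ |C| * (N * c) ^ (-1 - δ) := by
      intro z hz
      have h1 := le_of_mem_segment hz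
        (hlow p α (le_add_of_nonneg_right (abs_nonneg _)) (min_le_left _ _))
        (hlow q β (le_add_of_nonneg_left (abs_nonneg _)) (min_le_right _ _))
      have h2 := abs_re_im_le a b z
      have h3 : N * c ≤ ‖z‖ := by
        have h4 : N * m / 2 ≤ A * ‖z‖ := by
          have : (|a| + |b|) * ‖z‖ ≤ A * ‖z‖ := by
            gcongr
            simp [A]
          linarith
        have h5 : N * c = N * m / 2 / A := by
          simp only [c]
          field_simp
        rw [h5, div_le_iff₀ hA]
        linarith
      refine (hd z (hW.segment_subset (hp N hN0.le) (hq N hN0.le) hz) (hR.trans h3)).trans ?_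
      refine mul_le_mul (le_abs_self C) ?_ (by positivity) (abs_nonneg C)
      exact Real.rpow_le_rpow_of_nonpos (by positivity) h3 (by linarith)
    refine (norm_primitive_sub_le hW hP (hp N hN0.le) (hq N hN0.le) hM).trans ?_
    have hlen : ‖q + N * Complex.exp (β * Complex.I) - (p + N * Complex.exp (α * Complex.I))‖ ≤
        (‖q - p‖ + 2) * N := by
      have e : q + N * Complex.exp (β * Complex.I) - (p + N * Complex.exp (α * Complex.I)) =
          (q - p) + (N * Complex.exp (β * Complex.I) - N * Complex.exp (α * Complex.I)) := by ring
      rw [e]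
      have hn : ∀ α : ℝ, ‖(N : ℂ) * Complex.exp (α * Complex.I)‖ = N := fun α => by
        rw [norm_mul, Complex.norm_exp_ofReal_mul_I, Complex.norm_real,
          Real.norm_of_nonneg hN0.le, mul_one]
      have h1 := norm_add_le (q - p)
        (N * Complex.exp (β * Complex.I) - N * Complex.exp (α * Complex.I))
      have h2 := norm_sub_le ((N : ℂ) * Complex.exp (β * Complex.I))
        (N * Complex.exp (α * Complex.I))
      rw [hn, hn] at h2
      nlinarith [norm_nonneg (q - p)]
    calc _ ≤ |C| * (N * c) ^ (-1 - δ) * ((‖q - p‖ + 2) * N) := by gcongr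
      _ = |C| * c ^ (-1 - δ) * (‖q - p‖ + 2) * (N ^ (-1 - δ) * N) := by
        rw [Real.mul_rpow hN0.le hc.le]
        ring
      _ = _ := by
        rw [show -δ = (-1 - δ) + 1 by ring, Real.rpow_add hN0, Real.rpow_one]
  have h1 := (hray p α hp).add hfar
  have h2 := hray q β hq
  have h3 : Tendsto (fun N : ℝ => P (q + N * Complex.exp (β * Complex.I)) - P q) atTop
      (𝓝 (rayIntegral f p α - segIntegral f p q)) := by
    rw [segIntegral_eq_sub hW hf.continuousOn hP hp0 hq0]
    have h4 := h1.sub_const (P q - P p)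
    rw [add_zero] at h4
    refine h4.congr fun N => ?_
    ring
  rw [tendsto_nhds_unique h2 h3]
  ring

/-- `f` is `O(|z|^{-σ})` at `0` in `W`. -/
def SingularOn (f : ℂ → ℂ) (W : Set ℂ) (σ : ℝ) : Prop :=
  ∃ C, ∃ ρ > 0, ∀ z ∈ W, ‖z‖ ≤ ρ → ‖f z‖ ≤ C * ‖z‖ ^ (-σ)

lemma segIntegrable_zero {W : Set ℂ} {f : ℂ → ℂ} {p : ℂ} {σ : ℝ} (hσ : σ < 1) (hp0 : p ≠ 0)
    (hf : ContinuousOn f W) (hd : SingularOn f W σ)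
    (hp : ∀ u : ℝ, 0 < u → u ≤ 1 → u * p ∈ W) : SegIntegrable f 0 p := by
  obtain ⟨C, ρ, hρ, hd⟩ := hd
  have hpn : 0 < ‖p‖ := norm_pos_iff.mpr hp0
  have hc : ContinuousOn (fun u : ℝ => f (0 + u * (p - 0))) (Ioc 0 1) := by
    simp only [zero_add, sub_zero]
    exact hf.comp (by fun_prop) fun u hu => hp u hu.1 hu.2
  set τ := min 1 (ρ / ‖p‖)
  have hτ : 0 < τ := lt_min one_pos (by positivity)
  have hτ1 : τ ≤ 1 := min_le_left _ _
  have h1 : IntervalIntegrable (fun u : ℝ => f (0 + u * (p - 0))) volume 0 τ := by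
    have hr : IntervalIntegrable (fun u : ℝ => C * ‖p‖ ^ (-σ) * u ^ (-σ)) volume 0 τ :=
      (intervalIntegral.intervalIntegrable_rpow' (by linarith)).const_mul _
    rw [intervalIntegrable_iff_integrableOn_Ioc_of_le hτ.le] at hr ⊢
    refine Integrable.mono' hr ((hc.mono (Ioc_subset_Ioc_right hτ1)).aestronglyMeasurable
      measurableSet_Ioc) ?_
    refine (ae_restrict_iff' measurableSet_Ioc).mpr (Eventually.of_forall fun u hu => ?_)
    have hn : ‖(u : ℂ) * p‖ = u * ‖p‖ := by
      rw [norm_mul, Complex.norm_real, Real.norm_of_nonneg hu.1.le]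
    have h := hd (u * p) (hp u hu.1 (hu.2.trans hτ1)) (by
      rw [hn]
      calc u * ‖p‖ ≤ ρ / ‖p‖ * ‖p‖ := by
            gcongr
            exact hu.2.trans (min_le_right _ _)
        _ = ρ := by field_simp)
    rw [hn, Real.mul_rpow hu.1.le hpn.le] at h
    simp only [zero_add, sub_zero]
    linarith
  refine h1.trans (ContinuousOn.intervalIntegrable ?_)
  rw [uIcc_of_le hτ1]
  exact hc.mono fun u hu => ⟨hτ.trans_le hu.1, hu.2⟩

/-- Cauchy's theorem for a triangle with one vertex at an integrable singularity. -/
lemma segIntegral_zero_add {W : Set ℂ} {f : ℂ → ℂ} {p q : ℂ} {σ a b : ℝ} (hσ0 : 0 ≤ σ)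
    (hσ : σ < 1) (hW : Convex ℝ W) (hf : DifferentiableOn ℂ f W) (hd : SingularOn f W σ)
    (hp : ∀ u : ℝ, 0 < u → u ≤ 1 → u * p ∈ W) (hq : ∀ u : ℝ, 0 < u → u ≤ 1 → u * q ∈ W)
    (hα : 0 < a * p.re + b * p.im) (hβ : 0 < a * q.re + b * q.im) :
    segIntegral f 0 p + segIntegral f p q = segIntegral f 0 q := by
  obtain ⟨P, hP⟩ := hW.exists_forall_hasDerivWithinAt hf
  have hp0 : p ∈ W := by simpa using hp 1 one_pos le_rfl
  have hq0 : q ∈ W := by simpa using hq 1 one_pos le_rfl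
  have hside : ∀ p : ℂ, p ≠ 0 → (∀ u : ℝ, 0 < u → u ≤ 1 → u * p ∈ W) →
      Tendsto (fun δ : ℝ => P p - P (δ * p)) (𝓝[>] 0) (𝓝 (segIntegral f 0 p)) := by
    intro p hp0 hp
    have h0 := (segIntegrable_zero hσ hp0 hf.continuousOn hd hp).mul_const (p - 0)
    have h1 := intervalIntegral.continuousOn_primitive_interval_left
      ((intervalIntegrable_iff' (by finiteness)).mp h0) 0 left_mem_uIcc
    have h2 : Tendsto (fun δ : ℝ => ∫ u in δ..1, f (0 + u * (p - 0)) * (p - 0)) (𝓝[>] 0)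
        (𝓝 (segIntegral f 0 p)) := by
      refine h1.mono_left ?_
      rw [uIcc_of_le zero_le_one, ← nhdsWithin_Ioc_eq_nhdsGT one_pos]
      exact nhdsWithin_mono _ Ioc_subset_Icc_self
    refine h2.congr' ?_
    filter_upwards [Ioc_mem_nhdsGT one_pos] with δ hδ
    have := integral_line_eq_sub hf.continuousOn hP (p := 0) (v := p - 0) hδ.2
      fun u hu => by simpa using hp u (hδ.1.trans_le hu.1) hu.2
    simpa using this
  have hfar : Tendsto (fun δ : ℝ => P (δ * q) - P (δ * p)) (𝓝[>] 0) (𝓝 0) := by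
    obtain ⟨C, ρ, hρ, hd⟩ := hd
    set m := min (a * p.re + b * p.im) (a * q.re + b * q.im)
    have hm : 0 < m := lt_min hα hβ
    set A := |a| + |b| + 1
    have hA : 0 < A := by positivity
    set c := m / A
    have hc : 0 < c := by positivity
    have hzero : Tendsto (fun δ : ℝ => |C| * c ^ (-σ) * ‖q - p‖ * δ ^ (1 - σ)) (𝓝[>] 0)
        (𝓝 0) := by
      have h := ((Real.continuousAt_rpow_const 0 (1 - σ) (Or.inr (by linarith))).tendsto.mono_left
        (nhdsWithin_le_nhds (s := Ioi 0))).const_mul (|C| * c ^ (-σ) * ‖q - p‖)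
      rwa [Real.zero_rpow (by linarith), mul_zero] at h
    refine squeeze_zero_norm' ?_ hzero
    have hsm : ∀ᶠ δ : ℝ in 𝓝[>] 0, δ * (‖p‖ + ‖q‖) < ρ := by
      have : Tendsto (fun δ : ℝ => δ * (‖p‖ + ‖q‖)) (𝓝[>] 0) (𝓝 (0 * (‖p‖ + ‖q‖))) :=
        (tendsto_id.mono_left nhdsWithin_le_nhds).mul_const _
      rw [zero_mul] at this
      exact this.eventually (gt_mem_nhds hρ)
    filter_upwards [Ioc_mem_nhdsGT one_pos, hsm] with δ hδ hδρ
    have hpW := hp δ hδ.1 hδ.2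
    have hqW := hq δ hδ.1 hδ.2
    have hM : ∀ z ∈ segment ℝ ((δ : ℂ) * p) (δ * q), ‖f z‖ ≤ |C| * (δ * c) ^ (-σ) := by
      intro z hz
      have h1 : δ * m ≤ a * z.re + b * z.im := by
        refine le_of_mem_segment hz ?_ ?_
        · simp only [Complex.re_ofReal_mul, Complex.im_ofReal_mul]
          have := mul_le_mul_of_nonneg_left (min_le_left _ _ : m ≤ a * p.re + b * p.im) hδ.1.le
          linarith
        · simp only [Complex.re_ofReal_mul, Complex.im_ofReal_mul]
          have := mul_le_mul_of_nonneg_left (min_le_right _ _ : m ≤ a * q.re + b * q.im) hδ.1.le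
          linarith
      have h2 := abs_re_im_le a b z
      have h3 : δ * c ≤ ‖z‖ := by
        have h4 : δ * m ≤ A * ‖z‖ := by
          have : (|a| + |b|) * ‖z‖ ≤ A * ‖z‖ := by
            gcongr
            simp [A]
          linarith
        rw [show δ * c = δ * m / A by simp only [c]; ring, div_le_iff₀ hA]
        linarith
      have h5 : ‖z‖ ≤ ρ := by
        have hb : ∀ w : ℂ, ‖w‖ ≤ ‖p‖ + ‖q‖ → ‖(δ : ℂ) * w‖ ≤ ρ := fun w hw => by
          rw [norm_mul, Complex.norm_real, Real.norm_of_nonneg hδ.1.le]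
          exact (mul_le_mul_of_nonneg_left hw hδ.1.le).trans hδρ.le
        have hball := (convex_closedBall (0 : ℂ) ρ).segment_subset (x := (δ : ℂ) * p)
          (y := (δ : ℂ) * q)
          (mem_closedBall_zero_iff.mpr (hb p (le_add_of_nonneg_right (norm_nonneg _))))
          (mem_closedBall_zero_iff.mpr (hb q (le_add_of_nonneg_left (norm_nonneg _)))) hz
        exact mem_closedBall_zero_iff.mp hball
      refine (hd z (hW.segment_subset hpW hqW hz) h5).trans ?_
      refine mul_le_mul (le_abs_self C) ?_ (by positivity) (abs_nonneg C)
      exact Real.rpow_le_rpow_of_nonpos (mul_pos hδ.1 hc) h3 (by linarith)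
    refine (norm_primitive_sub_le hW hP hpW hqW hM).trans (le_of_eq ?_)
    rw [← mul_sub, norm_mul, Complex.norm_real, Real.norm_of_nonneg hδ.1.le,
      Real.mul_rpow hδ.1.le hc.le, show (1 - σ) = -σ + 1 by ring, Real.rpow_add hδ.1,
      Real.rpow_one]
    ring
  have hpn : p ≠ 0 := by
    rintro rfl
    simp at hα
  have hqn : q ≠ 0 := by
    rintro rfl
    simp at hβ
  have h1 := ((hside p hpn hp).sub hfar).add_const (P q - P p)
  have h2 := hside q hqn hq
  rw [segIntegral_eq_sub hW hf.continuousOn hP hp0 hq0]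
  rw [sub_zero] at h1
  refine tendsto_nhds_unique (h1.congr fun δ => ?_) h2
  ring

/-- A ray from the origin is the union of a segment and a ray. -/
lemma rayIntegral_zero_eq_add {f : ℂ → ℂ} {α T : ℝ} (hT : 0 < T)
    (h1 : SegIntegrable f 0 (T * Complex.exp (α * Complex.I)))
    (h2 : RayIntegrable f (T * Complex.exp (α * Complex.I)) α) :
    RayIntegrable f 0 α ∧ rayIntegral f 0 α =
      segIntegral f 0 (T * Complex.exp (α * Complex.I)) +
        rayIntegral f (T * Complex.exp (α * Complex.I)) α := by
  set w := Complex.exp (α * Complex.I)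
  set h : ℝ → ℂ := fun u => f (0 + u * w)
  have e1 : ∀ u : ℝ, f (0 + u * (T * w - 0)) = h (T * u) := fun u => by
    simp only [h]
    congr 1
    push_cast
    ring
  have e2 : ∀ u : ℝ, f (T * w + u * w) = h (u + T) := fun u => by
    simp only [h]
    congr 1
    push_cast
    ring
  have hI1 : IntervalIntegrable h volume 0 T := by
    have h1' : IntervalIntegrable (fun u => h (T * u)) volume (0 / T) (T / T) := by
      rw [zero_div, div_self hT.ne']
      exact h1.congr fun u _ => e1 u
    exact (IntervalIntegrable.comp_mul_left_iff hT.ne').mp h1'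
  have hpre : (fun u : ℝ => u + T) ⁻¹' Ioi T = Ioi 0 := by
    rw [preimage_add_const_Ioi, sub_self]
  have hmp := measurePreserving_add_right (volume : Measure ℝ) T
  have hme := measurableEmbedding_addRight T
  have hI2 : IntegrableOn h (Ioi T) := by
    rw [← hmp.integrableOn_comp_preimage hme, hpre]
    exact IntegrableOn.congr_fun h2 (fun u _ => e2 u) measurableSet_Ioi
  have hI : IntegrableOn h (Ioi 0) := by
    rw [← Ioc_union_Ioi_eq_Ioi hT.le]
    exact ((intervalIntegrable_iff_integrableOn_Ioc_of_le hT.le).mp hI1).union hI2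
  refine ⟨hI, ?_⟩
  have hs := intervalIntegral.integral_comp_mul_left (fun u => h u * w) (a := 0) (b := 1) hT.ne'
  rw [mul_zero, mul_one] at hs
  have hseg : segIntegral f 0 (T * w) = ∫ u in (0 : ℝ)..T, h u * w := by
    rw [segIntegral]
    have : ∀ u : ℝ, f (0 + u * (T * w - 0)) * (T * w - 0) = T * (h (T * u) * w) := fun u => by
      rw [e1]
      ring
    simp only [this]
    rw [intervalIntegral.integral_const_mul, hs, Complex.real_smul, Complex.ofReal_inv,
      mul_inv_cancel_left₀ (Complex.ofReal_ne_zero.mpr hT.ne')]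
  have hray : rayIntegral f (T * w) α = ∫ u in Ioi T, h u * w := by
    have := hmp.setIntegral_preimage_emb hme (fun u => h u * w) (Ioi T)
    rw [hpre] at this
    rw [← this, rayIntegral]
    exact setIntegral_congr_fun measurableSet_Ioi fun u _ => by simp only [w, ← e2]
  rw [hseg, hray, intervalIntegral.integral_of_le hT.le, rayIntegral,
    ← setIntegral_union Ioc_disjoint_Ioi_same measurableSet_Ioi
      (((intervalIntegrable_iff_integrableOn_Ioc_of_le hT.le).mp hI1).mul_const w)
      (hI2.mul_const w), Ioc_union_Ioi_eq_Ioi hT.le]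

end Contour

/-! ### Branches of the power -/

lemma cutLog_pi (z : ℂ) : cutLog Real.pi z = Complex.log z := by
  simp [cutLog]

lemma cutLog_zero (z : ℂ) : cutLog 0 z = Complex.log (-z) - Real.pi * Complex.I := by
  rw [cutLog]
  push_cast
  rw [zero_sub, neg_mul, neg_neg, Complex.exp_pi_mul_I, mul_neg_one]
  ring

lemma cutLog_eq_cutLog_pi {θ : ℝ} (hθ : θ ∈ Ioo (Real.pi / 2) Real.pi) {z : ℂ} (hz : z ≠ 0)
    (h : z.arg ≤ θ) : cutLog θ z = cutLog Real.pi z := by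
  have hpi := Real.pi_pos
  have hw : z * Complex.exp (-((θ - Real.pi : ℝ) * Complex.I)) =
      Complex.exp (Complex.log z - (θ - Real.pi : ℝ) * Complex.I) := by
    rw [sub_eq_add_neg (Complex.log z), Complex.exp_add, Complex.exp_log hz]
  have him : (Complex.log z - (θ - Real.pi : ℝ) * Complex.I).im = z.arg - (θ - Real.pi) := by
    rw [Complex.sub_im, Complex.log_im, Complex.im_ofReal_mul, Complex.I_im, mul_one]
  have := Complex.neg_pi_lt_arg z
  rw [cutLog_pi, cutLog, hw, Complex.log_exp (by rw [him]; linarith [hθ.2])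
    (by rw [him]; linarith)]
  ring

lemma cutLog_eq_cutLog_zero {θ : ℝ} (hθ : θ ∈ Ioo (Real.pi / 2) Real.pi) {z : ℂ} (hz : z ≠ 0)
    (h : θ - Real.pi < (-z).arg) : cutLog θ z = cutLog 0 z := by
  have hpi := Real.pi_pos
  have hw : z * Complex.exp (-((θ - Real.pi : ℝ) * Complex.I)) =
      Complex.exp (Complex.log (-z) - θ * Complex.I) := by
    have e : (-((θ - Real.pi : ℝ) * Complex.I)) = Real.pi * Complex.I - θ * Complex.I := by
      push_cast
      ring
    rw [e, Complex.exp_sub, Complex.exp_pi_mul_I, Complex.exp_sub,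
      Complex.exp_log (neg_ne_zero.mpr hz)]
    ring
  have him : (Complex.log (-z) - θ * Complex.I).im = (-z).arg - θ := by
    rw [Complex.sub_im, Complex.log_im, Complex.im_ofReal_mul, Complex.I_im, mul_one]
  have := Complex.arg_le_pi (-z)
  rw [cutLog_zero, cutLog, hw, Complex.log_exp (by rw [him]; linarith)
    (by rw [him]; linarith [hθ.1])]
  push_cast
  ring

lemma cutPow_eq_of_re_pos {θ : ℝ} (hθ : θ ∈ Ioo (Real.pi / 2) Real.pi) {z : ℂ} (hz : 0 < z.re)
    (w : ℂ) : cutPow θ z w = cutPow Real.pi z w := by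
  have h0 : z ≠ 0 := by
    rintro rfl
    simp at hz
  have h1 := (abs_lt.mp (Complex.abs_arg_lt_pi_div_two_iff.mpr (Or.inl hz))).2
  rw [cutPow, cutPow, cutLog_eq_cutLog_pi hθ h0 (by linarith [hθ.1])]

lemma cutPow_eq_of_im_neg {θ : ℝ} (hθ : θ ∈ Ioo (Real.pi / 2) Real.pi) {z : ℂ} (hz : z.im < 0)
    (w : ℂ) : cutPow θ z w = cutPow Real.pi z w := by
  have h0 : z ≠ 0 := by
    rintro rfl
    simp at hz
  have h1 := Complex.arg_neg_iff.mpr hz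
  rw [cutPow, cutPow, cutLog_eq_cutLog_pi hθ h0 (by linarith [hθ.1, Real.pi_pos])]

lemma cutPow_eq_zero_of_im_neg {θ : ℝ} (hθ : θ ∈ Ioo (Real.pi / 2) Real.pi) {z : ℂ}
    (hz : z.im < 0) (w : ℂ) : cutPow θ z w = cutPow 0 z w := by
  have h0 : z ≠ 0 := by
    rintro rfl
    simp at hz
  have h1 : 0 ≤ (-z).arg := Complex.arg_nonneg_iff.mpr (by simpa using hz.le)
  rw [cutPow, cutPow, cutLog_eq_cutLog_zero hθ h0 (by linarith [hθ.2])]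

/-- To the left of the cut the branch is the one of `log (-z) - π i`. -/
lemma cutPow_eq_zero_of_left {θ : ℝ} (hθ : θ ∈ Ioo (Real.pi / 2) Real.pi) {z : ℂ}
    (hz : 0 < z.im * Real.cos θ - z.re * Real.sin θ) (w : ℂ) : cutPow θ z w = cutPow 0 z w := by
  have h0 : z ≠ 0 := by
    rintro rfl
    simp at hz
  have h1 : θ - Real.pi < (-z).arg := by
    by_contra hcon
    push Not at hcon
    have h2 : z.im * Real.cos θ - z.re * Real.sin θ = ‖-z‖ * Real.sin (θ - (-z).arg) := by
      have hre := Complex.norm_mul_cos_arg (-z)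
      have him := Complex.norm_mul_sin_arg (-z)
      rw [Complex.neg_re] at hre
      rw [Complex.neg_im] at him
      rw [Real.sin_sub]
      linear_combination Real.cos θ * him - Real.sin θ * hre
    have h3 : Real.sin (θ - (-z).arg) ≤ 0 := by
      rw [← neg_nonneg, ← Real.sin_sub_pi]
      exact Real.sin_nonneg_of_nonneg_of_le_pi (by linarith)
        (by linarith [Complex.neg_pi_lt_arg (-z), hθ.2])
    rw [h2] at hz
    exact absurd hz (not_lt.mpr (mul_nonpos_of_nonneg_of_nonpos (norm_nonneg _) h3))
  rw [cutPow, cutPow, cutLog_eq_cutLog_zero hθ h0 h1]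

lemma differentiableOn_cutPow_pi {W : Set ℂ} (hW : W ⊆ Complex.slitPlane) (w : ℂ) :
    DifferentiableOn ℂ (fun z => cutPow Real.pi z w) W := by
  simp only [cutPow, cutLog_pi]
  exact ((differentiableOn_id.clog hW).const_mul w).cexp

lemma differentiableOn_cutPow_zero {W : Set ℂ} (hW : ∀ z ∈ W, -z ∈ Complex.slitPlane) (w : ℂ) :
    DifferentiableOn ℂ (fun z => cutPow 0 z w) W := by
  simp only [cutPow, cutLog_zero]
  exact (((differentiableOn_id.neg.clog hW).sub_const _).const_mul w).cexp

lemma norm_cutPow_le {θ : ℝ} (hθ0 : 0 ≤ θ) (hθ : θ ≤ Real.pi) {z : ℂ} (hz : z ≠ 0) (s : ℂ) :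
    ‖cutPow θ z (-s)‖ ≤ Real.exp (2 * Real.pi * |s.im|) * ‖z‖ ^ (-s.re) := by
  have hpi := Real.pi_pos
  set w := z * Complex.exp (-((θ - Real.pi : ℝ) * Complex.I))
  have hwn : ‖w‖ = ‖z‖ := by
    rw [norm_mul, ← neg_mul, ← Complex.ofReal_neg, Complex.norm_exp_ofReal_mul_I, mul_one]
  have hre : (cutLog θ z).re = Real.log ‖z‖ := by
    rw [cutLog, Complex.add_re, Complex.log_re, hwn, Complex.re_ofReal_mul, Complex.I_re, mul_zero,
      add_zero]
  have him : |(cutLog θ z).im| ≤ 2 * Real.pi := by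
    rw [cutLog, Complex.add_im, Complex.log_im, Complex.im_ofReal_mul, Complex.I_im, mul_one]
    have h1 := Complex.neg_pi_lt_arg w
    have h2 := Complex.arg_le_pi w
    rw [abs_le]
    constructor <;> linarith
  rw [cutPow, Complex.norm_exp, Complex.mul_re, hre, Complex.neg_re, Complex.neg_im,
    Real.rpow_def_of_pos (norm_pos_iff.mpr hz), ← Real.exp_add]
  apply Real.exp_le_exp.mpr
  have h3 : s.im * (cutLog θ z).im ≤ 2 * Real.pi * |s.im| := by
    refine (le_abs_self _).trans ?_
    rw [abs_mul, mul_comm]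
    gcongr
  linarith

/-- On the cut, the two branches are the limits from the right and from the left. -/
lemma cutPow_pi_cut {θ : ℝ} (hθ : θ ∈ Ioo (Real.pi / 2) Real.pi) {t : ℝ} (ht : 0 < t) (s : ℂ) :
    cutPow Real.pi (t * Complex.exp (θ * Complex.I)) (-s) =
      Complex.exp (-(s * θ * Complex.I)) * (t : ℂ) ^ (-s) := by
  have hpi := Real.pi_pos
  have hl : Complex.log (t * Complex.exp (θ * Complex.I)) = Complex.log t + θ * Complex.I := by
    rw [Complex.log_ofReal_mul ht (Complex.exp_ne_zero _), Complex.log_exp,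
      Complex.ofReal_log ht.le]
    · simp; linarith [hθ.1]
    · simp; linarith [hθ.2]
  rw [cutPow, cutLog_pi, hl, Complex.cpow_def_of_ne_zero (Complex.ofReal_ne_zero.mpr ht.ne'),
    ← Complex.exp_add]
  congr 1
  ring

lemma cutPow_zero_cut {θ : ℝ} (hθ : θ ∈ Ioo (Real.pi / 2) Real.pi) {t : ℝ} (ht : 0 < t) (s : ℂ) :
    cutPow 0 (t * Complex.exp (θ * Complex.I)) (-s) =
      Complex.exp (2 * Real.pi * s * Complex.I) *
        cutPow Real.pi (t * Complex.exp (θ * Complex.I)) (-s) := by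
  have hpi := Real.pi_pos
  have hl : Complex.log (-(t * Complex.exp (θ * Complex.I))) =
      Complex.log t + (θ - Real.pi : ℝ) * Complex.I := by
    have e : -((t : ℂ) * Complex.exp (θ * Complex.I)) =
        t * Complex.exp ((θ - Real.pi : ℝ) * Complex.I) := by
      push_cast
      rw [sub_mul, Complex.exp_sub, Complex.exp_pi_mul_I]
      ring
    rw [e, Complex.log_ofReal_mul ht (Complex.exp_ne_zero _), Complex.log_exp,
      Complex.ofReal_log ht.le]
    · rw [Complex.im_ofReal_mul, Complex.I_im]; linarith [hθ.1]
    · rw [Complex.im_ofReal_mul, Complex.I_im]; linarith [hθ.2]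
  rw [cutPow_pi_cut hθ ht, cutPow, cutLog_zero, hl,
    Complex.cpow_def_of_ne_zero (Complex.ofReal_ne_zero.mpr ht.ne'), ← Complex.exp_add,
    ← Complex.exp_add]
  congr 1
  push_cast
  ring

namespace Contour

variable {γ : Contour} {F : ℂ → ℂ} {θ ε : ℝ} {s : ℂ} {σ : Set ℂ}

lemma decaysOn_cutPow_mul {W : Set ℂ} (hθ0 : 0 ≤ θ) (hθ : θ ≤ Real.pi) (hF : DecaysOn F W ε)
    (hW : (0 : ℂ) ∉ W) : DecaysOn (fun z => cutPow θ z (-s) * F z) W (ε + s.re) := by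
  obtain ⟨C, R, hF⟩ := hF
  refine ⟨Real.exp (2 * Real.pi * |s.im|) * C, R, fun z hz hR => ?_⟩
  have hz0 : z ≠ 0 := fun h => hW (h ▸ hz)
  rw [norm_mul]
  calc _ ≤ Real.exp (2 * Real.pi * |s.im|) * ‖z‖ ^ (-s.re) * (C * ‖z‖ ^ (-1 - ε)) := by
        gcongr
        · exact norm_cutPow_le hθ0 hθ hz0 s
        · exact hF z hz hR
    _ = Real.exp (2 * Real.pi * |s.im|) * C * (‖z‖ ^ (-s.re) * ‖z‖ ^ (-1 - ε)) := by ring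
    _ = _ := by
      rw [← Real.rpow_add (norm_pos_iff.mpr hz0)]
      congr 2
      ring

lemma singularOn_cutPow_mul {W : Set ℂ} (hθ0 : 0 ≤ θ) (hθ : θ ≤ Real.pi)
    (hF : SingularOn F {0}ᶜ 0) (hW : (0 : ℂ) ∉ W) :
    SingularOn (fun z => cutPow θ z (-s) * F z) W (max s.re 0) := by
  obtain ⟨C, ρ, hρ, hF⟩ := hF
  refine ⟨Real.exp (2 * Real.pi * |s.im|) * |C|, min ρ 1, lt_min hρ one_pos, fun z hz hR => ?_⟩
  have hz0 : z ≠ 0 := fun h => hW (h ▸ hz)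
  have hzp := norm_pos_iff.mpr hz0
  have h1 := hF z hz0 (hR.trans (min_le_left _ _))
  rw [neg_zero, Real.rpow_zero, mul_one] at h1
  rw [norm_mul]
  calc _ ≤ Real.exp (2 * Real.pi * |s.im|) * ‖z‖ ^ (-s.re) * |C| := by
        gcongr
        · exact norm_cutPow_le hθ0 hθ hz0 s
        · exact h1.trans (le_abs_self C)
    _ = Real.exp (2 * Real.pi * |s.im|) * |C| * ‖z‖ ^ (-s.re) := by ring
    _ ≤ _ := by
      refine mul_le_mul_of_nonneg_left ?_ (by positivity)
      exact Real.rpow_le_rpow_of_exponent_ge hzp (hR.trans (min_le_right _ _))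
        (neg_le_neg (le_max_left _ _))

/-! ### Deformation of the contour to the cut -/

/-- The part of the exterior above the contour. -/
def upperPart (γ : Contour) : Set ℂ :=
  {z | γ.η ≤ z.im} ∩ {z | γ.η + (z.re - γ.r) * Real.tan γ.φ ≤ z.im}

/-- The part of the exterior below the contour. -/
def lowerPart (γ : Contour) : Set ℂ :=
  {z | z.im ≤ -γ.η} ∩ {z | z.im ≤ -(γ.η + (z.re - γ.r) * Real.tan γ.φ)}

/-- The vertical half-strip above the segment `[-r - iκ, r - iκ]`, which contains `0`. -/
def pocket (γ : Contour) : Set ℂ := ({z | -γ.r ≤ z.re} ∩ {z | z.re ≤ γ.r}) ∩ {z | -γ.κ ≤ z.im}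

lemma convex_upperPart (γ : Contour) : Convex ℝ γ.upperPart := by
  refine (convex_halfSpace_im_ge _).inter ?_
  intro z hz w hw a b ha hb hab
  simp only [mem_ofPred_eq, Complex.add_re, Complex.add_im, Complex.real_smul,
    Complex.re_ofReal_mul, Complex.im_ofReal_mul] at hz hw ⊢
  obtain rfl : b = 1 - a := by linarith
  have h1 := mul_le_mul_of_nonneg_left hz ha
  have h2 := mul_le_mul_of_nonneg_left hw hb
  linarith

lemma convex_lowerPart (γ : Contour) : Convex ℝ γ.lowerPart := by
  refine (convex_halfSpace_im_le _).inter ?_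
  intro z hz w hw a b ha hb hab
  simp only [mem_ofPred_eq, Complex.add_re, Complex.add_im, Complex.real_smul,
    Complex.re_ofReal_mul, Complex.im_ofReal_mul] at hz hw ⊢
  obtain rfl : b = 1 - a := by linarith
  have h1 := mul_le_mul_of_nonneg_left hz ha
  have h2 := mul_le_mul_of_nonneg_left hw hb
  linarith

lemma convex_pocket (γ : Contour) : Convex ℝ γ.pocket :=
  ((convex_halfSpace_re_ge _).inter (convex_halfSpace_re_le _)).inter (convex_halfSpace_im_ge _)

lemma upperPart_subset (γ : Contour) (hκ : 0 < γ.κ) (hκη : γ.κ < γ.η) :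
    γ.upperPart ⊆ γ.insideᶜ := by
  rintro z ⟨h1, h2⟩ (⟨-, -, h⟩ | ⟨-, -, -, h⟩ | ⟨-, h⟩)
  · exact absurd ((le_abs_self _).trans_lt h) (not_lt.mpr h1)
  · have : γ.η ≤ z.im := h1
    linarith
  · exact absurd ((le_abs_self _).trans_lt h) (not_lt.mpr h2)

lemma lowerPart_subset (γ : Contour) : γ.lowerPart ⊆ γ.insideᶜ := by
  rintro z ⟨h1, h2⟩ (⟨-, -, h⟩ | ⟨-, -, h, -⟩ | ⟨-, h⟩)
  · have h1' : z.im ≤ -γ.η := h1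
    linarith [(neg_le_abs z.im).trans_lt h]
  · exact absurd h (not_lt.mpr h1)
  · have h2' : z.im ≤ -(γ.η + (z.re - γ.r) * Real.tan γ.φ) := h2
    linarith [(neg_le_abs z.im).trans_lt h]

lemma pocket_subset (γ : Contour) : γ.pocket ⊆ γ.insideᶜ := by
  rintro z ⟨⟨h1, h2⟩, h3⟩ (⟨-, h, -⟩ | ⟨-, -, -, h⟩ | ⟨h, -⟩)
  · exact absurd h (not_lt.mpr h1)
  · exact absurd h (not_lt.mpr h3)
  · exact absurd h (not_lt.mpr h2)

lemma left_subset (γ : Contour) (hr : 0 < γ.r) (hra : γ.r < γ.a) :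
    {z : ℂ | z.re ≤ -γ.a} ⊆ γ.insideᶜ := by
  rintro z hz (⟨h, -, -⟩ | ⟨h, -⟩ | ⟨h, -⟩) <;> simp only [mem_ofPred_eq] at hz <;> linarith

lemma segIntegral_congr_of_convex {U : Set ℂ} (hU : Convex ℝ U) {f g : ℂ → ℂ}
    (h : ∀ z ∈ U, f z = g z) {p q : ℂ} (hp : p ∈ U) (hq : q ∈ U) :
    segIntegral f p q = segIntegral g p q :=
  segIntegral_congr fun _ hu => h _ (add_mul_sub_mem hU hp hq (Ioo_subset_Icc_self hu))

lemma SegIntegrable.congr_of_convex {U : Set ℂ} (hU : Convex ℝ U) {f g : ℂ → ℂ} {p q : ℂ}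
    (hf : SegIntegrable f p q) (h : ∀ z ∈ U, f z = g z) (hp : p ∈ U) (hq : q ∈ U) :
    SegIntegrable g p q := by
  refine IntervalIntegrable.congr (fun u hu => ?_) hf
  rw [uIoc_of_le zero_le_one] at hu
  exact h _ (add_mul_sub_mem hU hp hq (Ioc_subset_Icc_self hu))

/-- The integrand with the branch of the power that is cut along `{t e^{iθ'} | t ≥ 0}`. For
`θ' = π` it continues the integrand across the cut `R_θ` from the right, for `θ' = 0` from the
left. -/
noncomputable def powMul (F : ℂ → ℂ) (s : ℂ) (θ' : ℝ) (z : ℂ) : ℂ := cutPow θ' z (-s) * F z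

lemma differentiableOn_powMul_pi {W V : Set ℂ} (hF : DifferentiableOn ℂ F V) (hV : W ⊆ V)
    (hW : W ⊆ Complex.slitPlane) : DifferentiableOn ℂ (powMul F s Real.pi) W :=
  (differentiableOn_cutPow_pi hW (-s)).mul (hF.mono hV)

lemma differentiableOn_powMul_zero {W V : Set ℂ} (hF : DifferentiableOn ℂ F V) (hV : W ⊆ V)
    (hW : ∀ z ∈ W, -z ∈ Complex.slitPlane) : DifferentiableOn ℂ (powMul F s 0) W :=
  (differentiableOn_cutPow_zero hW (-s)).mul (hF.mono hV)

lemma add_mul_exp_re (p : ℂ) (u α : ℝ) :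
    (p + u * Complex.exp (α * Complex.I)).re = p.re + u * Real.cos α := by
  rw [Complex.add_re, Complex.re_ofReal_mul, Complex.exp_ofReal_mul_I_re]

lemma add_mul_exp_im (p : ℂ) (u α : ℝ) :
    (p + u * Complex.exp (α * Complex.I)).im = p.im + u * Real.sin α := by
  rw [Complex.add_im, Complex.im_ofReal_mul, Complex.exp_ofReal_mul_I_im]

/-- The hypotheses on the function: holomorphic outside the contour and off `0`, decaying at
infinity outside the contour, and bounded at `0`. -/
structure IsDeformable (γ : Contour) (F : ℂ → ℂ) (ε : ℝ) : Prop where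
  diff : DifferentiableOn ℂ F (γ.insideᶜ \ {0})
  decay : DecaysOn F γ.insideᶜ ε
  bounded : SingularOn F {0}ᶜ 0

lemma Admissible.eta_pos (hγ : γ.Admissible θ σ) : 0 < γ.η := hγ.kappa_pos.trans hγ.kappa_lt_eta

lemma sin_pos_of_mem (hθ : θ ∈ Ioo (Real.pi / 2) Real.pi) : 0 < Real.sin θ :=
  Real.sin_pos_of_pos_of_lt_pi (by linarith [hθ.1, Real.pi_pos]) hθ.2

lemma cos_neg_of_mem (hθ : θ ∈ Ioo (Real.pi / 2) Real.pi) : Real.cos θ < 0 :=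
  Real.cos_neg_of_pi_div_two_lt_of_lt hθ.1 (by linarith [hθ.2, Real.pi_pos])

lemma Admissible.cos_pos (hγ : γ.Admissible θ σ) : 0 < Real.cos γ.φ :=
  Real.cos_pos_of_mem_Ioo ⟨by linarith [hγ.phi_nonneg, Real.pi_pos], hγ.phi_lt⟩

lemma Admissible.sin_nonneg (hγ : γ.Admissible θ σ) : 0 ≤ Real.sin γ.φ :=
  Real.sin_nonneg_of_nonneg_of_le_pi hγ.phi_nonneg (by linarith [hγ.phi_lt, Real.pi_pos])

lemma Admissible.tan_nonneg (hγ : γ.Admissible θ σ) : 0 ≤ Real.tan γ.φ := by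
  rw [Real.tan_eq_sin_div_cos]
  exact div_nonneg hγ.sin_nonneg hγ.cos_pos.le

/-- The point of the cut at the height `η`. -/
noncomputable def cutPoint (γ : Contour) (θ : ℝ) : ℂ :=
  ((γ.η / Real.sin θ : ℝ) : ℂ) * Complex.exp (θ * Complex.I)

lemma cutPoint_im (hθ : θ ∈ Ioo (Real.pi / 2) Real.pi) : (γ.cutPoint θ).im = γ.η := by
  have := (sin_pos_of_mem hθ).ne'
  rw [cutPoint, Complex.im_ofReal_mul, Complex.exp_ofReal_mul_I_im]
  field_simp

lemma cutPoint_re : (γ.cutPoint θ).re = γ.η / Real.sin θ * Real.cos θ := by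
  rw [cutPoint, Complex.re_ofReal_mul, Complex.exp_ofReal_mul_I_re]

lemma cutPoint_re_neg (hθ : θ ∈ Ioo (Real.pi / 2) Real.pi) (hγ : γ.Admissible θ σ) :
    (γ.cutPoint θ).re < 0 := by
  rw [cutPoint_re]
  exact mul_neg_of_pos_of_neg (div_pos hγ.eta_pos (sin_pos_of_mem hθ)) (cos_neg_of_mem hθ)

lemma neg_lt_cutPoint_re (hθ : θ ∈ Ioo (Real.pi / 2) Real.pi) (hγ : γ.Admissible θ σ) :
    -γ.r < (γ.cutPoint θ).re := by
  have hs := sin_pos_of_mem hθ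
  rw [cutPoint_re, div_mul_eq_mul_div, lt_div_iff₀ hs]
  exact hγ.corner_left

lemma upperRay_mem (hγ : γ.Admissible θ σ) {u : ℝ} (hu : 0 ≤ u) :
    pt γ.r γ.η + u * Complex.exp (γ.φ * Complex.I) ∈ γ.upperPart := by
  have hc := hγ.cos_pos.ne'
  have hs := mul_nonneg hu hγ.sin_nonneg
  constructor <;> simp only [mem_ofPred_eq, add_mul_exp_re, add_mul_exp_im, pt]
  · linarith
  · have h : (γ.r + u * Real.cos γ.φ - γ.r) * Real.tan γ.φ = u * Real.sin γ.φ := by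
      rw [Real.tan_eq_sin_div_cos]
      field_simp
      ring
    linarith

lemma lowerRay_mem (hγ : γ.Admissible θ σ) {u : ℝ} (hu : 0 ≤ u) :
    pt γ.r (-γ.η) + u * Complex.exp ((-γ.φ : ℝ) * Complex.I) ∈ γ.lowerPart := by
  have hc := hγ.cos_pos.ne'
  have hs := mul_nonneg hu hγ.sin_nonneg
  constructor <;> simp only [mem_ofPred_eq, add_mul_exp_re, add_mul_exp_im, pt, Real.cos_neg,
    Real.sin_neg]
  · linarith
  · have h : (γ.r + u * Real.cos γ.φ - γ.r) * Real.tan γ.φ = u * Real.sin γ.φ := by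
      rw [Real.tan_eq_sin_div_cos]
      field_simp
      ring
    linarith

lemma mem_upperPart_of_re_le (hγ : γ.Admissible θ σ) {z : ℂ} (h1 : γ.η ≤ z.im)
    (h2 : z.re ≤ γ.r) : z ∈ γ.upperPart := by
  refine ⟨h1, ?_⟩
  have := mul_nonneg (sub_nonneg.mpr h2) hγ.tan_nonneg
  simp only [mem_ofPred_eq]
  linarith

lemma mem_lowerPart_of_re_le (hγ : γ.Admissible θ σ) {z : ℂ} (h1 : z.im ≤ -γ.η)
    (h2 : z.re ≤ γ.r) : z ∈ γ.lowerPart := by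
  refine ⟨h1, ?_⟩
  have := mul_nonneg (sub_nonneg.mpr h2) hγ.tan_nonneg
  simp only [mem_ofPred_eq]
  linarith

lemma cutRay_mem (hθ : θ ∈ Ioo (Real.pi / 2) Real.pi) (hγ : γ.Admissible θ σ) {u : ℝ}
    (hu : 0 ≤ u) : γ.cutPoint θ + u * Complex.exp (θ * Complex.I) ∈ γ.upperPart := by
  have h1 := mul_nonneg hu (sin_pos_of_mem hθ).le
  have h2 := mul_nonpos_of_nonneg_of_nonpos hu (cos_neg_of_mem hθ).le
  refine mem_upperPart_of_re_le hγ ?_ ?_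
  · rw [add_mul_exp_im, cutPoint_im hθ]
    linarith
  · rw [add_mul_exp_re]
    linarith [cutPoint_re_neg hθ hγ, hγ.r_pos]

lemma IsDeformable.decaysOn {W : Set ℂ} (hF : γ.IsDeformable F ε) {θ' : ℝ} (hθ0 : 0 ≤ θ')
    (hθ : θ' ≤ Real.pi) (hW : W ⊆ γ.insideᶜ \ {0}) :
    DecaysOn (powMul F s θ') W (ε + s.re) :=
  decaysOn_cutPow_mul hθ0 hθ (hF.decay.mono fun _ hz => (hW hz).1) fun h => (hW h).2 rfl

lemma IsDeformable.singularOn {W : Set ℂ} (hF : γ.IsDeformable F ε) {θ' : ℝ} (hθ0 : 0 ≤ θ')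
    (hθ : θ' ≤ Real.pi) (hW : W ⊆ γ.insideᶜ \ {0}) :
    SingularOn (powMul F s θ') W (max s.re 0) :=
  singularOn_cutPow_mul hθ0 hθ hF.bounded fun h => (hW h).2 rfl

lemma mem_slitPlane_of_im_ne_zero {z : ℂ} (h : z.im ≠ 0) : z ∈ Complex.slitPlane := Or.inr h

lemma neg_mem_slitPlane_of_im_ne_zero {z : ℂ} (h : z.im ≠ 0) : -z ∈ Complex.slitPlane :=
  Or.inr (by simpa using h)

lemma neg_mem_slitPlane_of_re_neg {z : ℂ} (h : z.re < 0) : -z ∈ Complex.slitPlane :=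
  Or.inl (by simpa using h)

lemma im_ne_zero_of_mem_upperPart (hγ : γ.Admissible θ σ) {z : ℂ} (hz : z ∈ γ.upperPart) :
    z.im ≠ 0 := (hγ.eta_pos.trans_le hz.1).ne'

lemma im_neg_of_mem_lowerPart (hγ : γ.Admissible θ σ) {z : ℂ} (hz : z ∈ γ.lowerPart) :
    z.im < 0 := by
  have h1 : z.im ≤ -γ.η := hz.1
  linarith [hγ.eta_pos]

lemma upperPart_subset_sdiff (hγ : γ.Admissible θ σ) : γ.upperPart ⊆ γ.insideᶜ \ {0} :=
  fun z hz => ⟨γ.upperPart_subset hγ.kappa_pos hγ.kappa_lt_eta hz, by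
    rintro rfl
    exact im_ne_zero_of_mem_upperPart hγ hz rfl⟩

lemma lowerPart_subset_sdiff (hγ : γ.Admissible θ σ) : γ.lowerPart ⊆ γ.insideᶜ \ {0} :=
  fun z hz => ⟨γ.lowerPart_subset hz, by
    rintro rfl
    exact (im_neg_of_mem_lowerPart hγ hz).ne rfl⟩

lemma left_subset_sdiff (hγ : γ.Admissible θ σ) :
    {z : ℂ | z.re ≤ -γ.a} ⊆ γ.insideᶜ \ {0} :=
  fun z hz => ⟨γ.left_subset hγ.r_pos hγ.r_lt_a hz, by
    rintro rfl
    have h : (0 : ℝ) ≤ -γ.a := hz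
    linarith [hγ.r_pos, hγ.r_lt_a]⟩

lemma differentiableOn_powMul_upperPart (hγ : γ.Admissible θ σ) (hF : γ.IsDeformable F ε) :
    DifferentiableOn ℂ (powMul F s Real.pi) γ.upperPart ∧
      DifferentiableOn ℂ (powMul F s 0) γ.upperPart :=
  ⟨differentiableOn_powMul_pi hF.diff (upperPart_subset_sdiff hγ) fun _ hz =>
    mem_slitPlane_of_im_ne_zero (im_ne_zero_of_mem_upperPart hγ hz),
  differentiableOn_powMul_zero hF.diff (upperPart_subset_sdiff hγ) fun _ hz =>
    neg_mem_slitPlane_of_im_ne_zero (im_ne_zero_of_mem_upperPart hγ hz)⟩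

lemma differentiableOn_powMul_lowerPart (hγ : γ.Admissible θ σ) (hF : γ.IsDeformable F ε) :
    DifferentiableOn ℂ (powMul F s 0) γ.lowerPart :=
  differentiableOn_powMul_zero hF.diff (lowerPart_subset_sdiff hγ) fun _ hz =>
    neg_mem_slitPlane_of_im_ne_zero (im_neg_of_mem_lowerPart hγ hz).ne

lemma differentiableOn_powMul_left (hγ : γ.Admissible θ σ) (hF : γ.IsDeformable F ε) :
    DifferentiableOn ℂ (powMul F s 0) {z : ℂ | z.re ≤ -γ.a} :=
  differentiableOn_powMul_zero hF.diff (left_subset_sdiff hγ) fun z hz =>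
    neg_mem_slitPlane_of_re_neg (by
      have h : z.re ≤ -γ.a := hz
      linarith [hγ.r_pos, hγ.r_lt_a])

lemma rayIntegral_upper (hθ : θ ∈ Ioo (Real.pi / 2) Real.pi) (hγ : γ.Admissible θ σ)
    (hF : γ.IsDeformable F ε) (hs : -ε < s.re) :
    rayIntegral (powMul F s Real.pi) (pt γ.r γ.η) γ.φ =
      segIntegral (powMul F s Real.pi) (pt γ.r γ.η) (γ.cutPoint θ) +
        rayIntegral (powMul F s Real.pi) (γ.cutPoint θ) θ := by
  have hsin := sin_pos_of_mem hθ
  have hcos := cos_neg_of_mem hθ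
  -- the functional `sin θ · x + (1 - cos θ) · y` is positive in both directions `φ` and `θ`
  refine rayIntegral_eq_add (a := Real.sin θ) (b := 1 - Real.cos θ) (δ := ε + s.re) (by linarith)
    γ.convex_upperPart (differentiableOn_powMul_upperPart hγ hF).1
    (hF.decaysOn Real.pi_pos.le le_rfl (upperPart_subset_sdiff hγ))
    (fun u hu => upperRay_mem hγ hu) (fun u hu => cutRay_mem hθ hγ hu) ?_ ?_
  · have h1 := mul_pos hsin hγ.cos_pos
    have h2 := mul_nonneg (by linarith : 0 ≤ 1 - Real.cos θ) hγ.sin_nonneg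
    linarith
  · linarith

lemma leftRay_mem_upperPart (hγ : γ.Admissible θ σ) {u : ℝ} (hu : 0 ≤ u) :
    pt (-γ.a) γ.η + u * Complex.exp (Real.pi * Complex.I) ∈ γ.upperPart := by
  refine mem_upperPart_of_re_le hγ ?_ ?_
  · simp [pt]
  · rw [add_mul_exp_re, Real.cos_pi]
    simp only [pt]
    linarith [hγ.r_pos, hγ.r_lt_a]

lemma leftRay_mem_left (γ : Contour) {u : ℝ} (hu : 0 ≤ u) :
    pt (-γ.a) γ.η + u * Complex.exp (Real.pi * Complex.I) ∈ {z : ℂ | z.re ≤ -γ.a} := by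
  rw [mem_ofPred_eq, add_mul_exp_re, Real.cos_pi]
  simp only [pt]
  linarith

lemma downRay_mem_left (γ : Contour) (u : ℝ) :
    pt (-γ.a) (-γ.η) + u * Complex.exp ((-(Real.pi / 2) : ℝ) * Complex.I) ∈
      {z : ℂ | z.re ≤ -γ.a} := by
  rw [mem_ofPred_eq, add_mul_exp_re, Real.cos_neg, Real.cos_pi_div_two]
  simp [pt]

lemma downRay_mem_lowerPart (hγ : γ.Admissible θ σ) {u : ℝ} (hu : 0 ≤ u) :
    pt (-γ.a) (-γ.η) + u * Complex.exp ((-(Real.pi / 2) : ℝ) * Complex.I) ∈ γ.lowerPart := by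
  refine mem_lowerPart_of_re_le hγ ?_ ?_
  · rw [add_mul_exp_im, Real.sin_neg, Real.sin_pi_div_two]
    simp only [pt]
    linarith
  · rw [add_mul_exp_re, Real.cos_neg, Real.cos_pi_div_two]
    simp only [pt]
    linarith [hγ.r_pos, hγ.r_lt_a]

/-- To the left of the cut, the ray is rotated to the lower end of the contour, in three steps. -/
lemma rayIntegral_left (hθ : θ ∈ Ioo (Real.pi / 2) Real.pi) (hγ : γ.Admissible θ σ)
    (hF : γ.IsDeformable F ε) (hs : -ε < s.re) :
    rayIntegral (powMul F s 0) (γ.cutPoint θ) θ =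
      segIntegral (powMul F s 0) (γ.cutPoint θ) (pt (-γ.r) γ.η) +
        segIntegral (powMul F s 0) (pt (-γ.r) γ.η) (pt (-γ.a) γ.η) +
        segIntegral (powMul F s 0) (pt (-γ.a) γ.η) (pt (-γ.a) (-γ.η)) +
        segIntegral (powMul F s 0) (pt (-γ.a) (-γ.η)) (pt γ.r (-γ.η)) +
        rayIntegral (powMul F s 0) (pt γ.r (-γ.η)) (-γ.φ) := by
  have hsin := sin_pos_of_mem hθ
  have hcos := cos_neg_of_mem hθ
  have hδ : 0 < ε + s.re := by linarith
  have h1 := rayIntegral_eq_add (a := -1) (b := 1) hδ γ.convex_upperPart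
    (differentiableOn_powMul_upperPart hγ hF).2
    (hF.decaysOn le_rfl Real.pi_pos.le (upperPart_subset_sdiff hγ))
    (fun u hu => cutRay_mem hθ hγ hu) (fun u hu => leftRay_mem_upperPart hγ hu)
    (by linarith) (by simp)
  have h2 := rayIntegral_eq_add (a := -1) (b := -1) hδ (convex_halfSpace_re_le (-γ.a))
    (differentiableOn_powMul_left hγ hF)
    (hF.decaysOn le_rfl Real.pi_pos.le (left_subset_sdiff hγ))
    (fun u hu => γ.leftRay_mem_left hu) (fun u _ => γ.downRay_mem_left u)
    (by simp) (by simp)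
  have h3 := rayIntegral_eq_add (a := 1) (b := -1) hδ γ.convex_lowerPart
    (differentiableOn_powMul_lowerPart hγ hF)
    (hF.decaysOn le_rfl Real.pi_pos.le (lowerPart_subset_sdiff hγ))
    (fun u hu => downRay_mem_lowerPart hγ hu) (fun u hu => lowerRay_mem hγ hu)
    (by simp) (by
      rw [Real.cos_neg, Real.sin_neg]
      linarith [hγ.cos_pos, hγ.sin_nonneg])
  have h4 := segIntegral_add γ.convex_upperPart
    (differentiableOn_powMul_upperPart (s := s) hγ hF).2 (p := γ.cutPoint θ)
    (q := pt (-γ.r) γ.η) (r := pt (-γ.a) γ.η)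
    (by simpa using cutRay_mem hθ hγ le_rfl)
    (mem_upperPart_of_re_le hγ le_rfl (by simp only [pt]; linarith [hγ.r_pos]))
    (mem_upperPart_of_re_le hγ le_rfl (by simp only [pt]; linarith [hγ.r_pos, hγ.r_lt_a]))
  rw [h1, h2, h3, ← h4]
  ring

lemma smul_mem_re {r : ℝ} {z : ℂ} {u : ℝ} (hu0 : 0 ≤ u) (hu : u ≤ 1) (hr : 0 ≤ r)
    (h : -r ≤ z.re ∧ z.re ≤ r) : -r ≤ ((u : ℂ) * z).re ∧ ((u : ℂ) * z).re ≤ r := by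
  rw [Complex.re_ofReal_mul]
  constructor <;> nlinarith

lemma smul_mem_im {k : ℝ} {z : ℂ} {u : ℝ} (hu0 : 0 ≤ u) (hu : u ≤ 1) (hk : 0 ≤ k)
    (h : -k ≤ z.im) : -k ≤ ((u : ℂ) * z).im := by
  rw [Complex.im_ofReal_mul]
  nlinarith

lemma smul_mem_pocket (hγ : γ.Admissible θ σ) {z : ℂ} (hz : z ∈ γ.pocket) {u : ℝ} (hu0 : 0 ≤ u)
    (hu : u ≤ 1) : (u : ℂ) * z ∈ γ.pocket :=
  ⟨smul_mem_re hu0 hu hγ.r_pos.le hz.1, smul_mem_im hu0 hu hγ.kappa_pos.le hz.2⟩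

/-- The part of the pocket where the real-linear functional `a x + b y` is positive. -/
def halfPocket (γ : Contour) (a b : ℝ) : Set ℂ := γ.pocket ∩ {z | 0 < a * z.re + b * z.im}

lemma convex_halfPocket (γ : Contour) (a b : ℝ) : Convex ℝ (γ.halfPocket a b) := by
  refine γ.convex_pocket.inter ?_
  refine convex_halfSpace_gt (f := fun z : ℂ => a * z.re + b * z.im)
    ⟨fun x y => ?_, fun c x => ?_⟩ 0
  · simp only [Complex.add_re, Complex.add_im]
    ring
  · simp only [Complex.real_smul, Complex.re_ofReal_mul, Complex.im_ofReal_mul, smul_eq_mul]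
    ring

lemma halfPocket_subset (γ : Contour) (a b : ℝ) : γ.halfPocket a b ⊆ γ.insideᶜ \ {0} :=
  fun z hz => ⟨γ.pocket_subset hz.1, by
    rintro rfl
    simpa using hz.2⟩

lemma smul_mem_halfPocket (hγ : γ.Admissible θ σ) {a b : ℝ} {z : ℂ} (hz : z ∈ γ.halfPocket a b)
    {u : ℝ} (hu0 : 0 < u) (hu : u ≤ 1) : (u : ℂ) * z ∈ γ.halfPocket a b := by
  refine ⟨smul_mem_pocket hγ hz.1 hu0.le hu, ?_⟩
  have h := mul_pos hu0 hz.2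
  rw [mem_ofPred_eq, Complex.re_ofReal_mul, Complex.im_ofReal_mul]
  linarith

lemma triangle_pi (hγ : γ.Admissible θ σ) (hF : γ.IsDeformable F ε) (hs : s.re < 1) {a b : ℝ}
    (hslit : γ.halfPocket a b ⊆ Complex.slitPlane) {p q : ℂ} (hp : p ∈ γ.halfPocket a b)
    (hq : q ∈ γ.halfPocket a b) :
    segIntegral (powMul F s Real.pi) 0 p + segIntegral (powMul F s Real.pi) p q =
      segIntegral (powMul F s Real.pi) 0 q :=
  segIntegral_zero_add (le_max_right s.re 0) (max_lt hs one_pos) (γ.convex_halfPocket a b)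
    (differentiableOn_powMul_pi hF.diff (γ.halfPocket_subset a b) hslit)
    (hF.singularOn Real.pi_pos.le le_rfl (γ.halfPocket_subset a b))
    (fun _ hu0 hu => smul_mem_halfPocket hγ hp hu0 hu)
    (fun _ hu0 hu => smul_mem_halfPocket hγ hq hu0 hu) hp.2 hq.2

lemma triangle_zero (hγ : γ.Admissible θ σ) (hF : γ.IsDeformable F ε) (hs : s.re < 1) {a b : ℝ}
    (hslit : ∀ z ∈ γ.halfPocket a b, -z ∈ Complex.slitPlane) {p q : ℂ}
    (hp : p ∈ γ.halfPocket a b) (hq : q ∈ γ.halfPocket a b) :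
    segIntegral (powMul F s 0) 0 p + segIntegral (powMul F s 0) p q =
      segIntegral (powMul F s 0) 0 q :=
  segIntegral_zero_add (le_max_right s.re 0) (max_lt hs one_pos) (γ.convex_halfPocket a b)
    (differentiableOn_powMul_zero hF.diff (γ.halfPocket_subset a b) hslit)
    (hF.singularOn le_rfl Real.pi_pos.le (γ.halfPocket_subset a b))
    (fun _ hu0 hu => smul_mem_halfPocket hγ hp hu0 hu)
    (fun _ hu0 hu => smul_mem_halfPocket hγ hq hu0 hu) hp.2 hq.2

lemma halfPocket_im_pos {z : ℂ} (hz : z ∈ γ.halfPocket 0 1) : 0 < z.im := by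
  simpa using hz.2

lemma halfPocket_im_neg {z : ℂ} (hz : z ∈ γ.halfPocket 0 (-1)) : z.im < 0 := by
  simpa using hz.2

lemma halfPocket_re_pos {z : ℂ} (hz : z ∈ γ.halfPocket 1 0) : 0 < z.re := by
  simpa using hz.2

lemma halfPocket_re_neg {z : ℂ} (hz : z ∈ γ.halfPocket (-1) 0) : z.re < 0 := by
  simpa using hz.2

lemma pt_mem_pocket (hγ : γ.Admissible θ σ) {x y : ℝ} (hx : x = γ.r ∨ x = -γ.r)
    (hy : y = γ.η ∨ y = -γ.κ) : pt x y ∈ γ.pocket := by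
  have h1 := hγ.r_pos
  have h2 := hγ.eta_pos
  have h3 := hγ.kappa_pos
  rcases hx with rfl | rfl <;> rcases hy with rfl | rfl <;>
    refine ⟨⟨?_, ?_⟩, ?_⟩ <;> simp only [mem_ofPred_eq, pt] <;> linarith

lemma cutPoint_mem_halfPocket (hθ : θ ∈ Ioo (Real.pi / 2) Real.pi) (hγ : γ.Admissible θ σ) :
    γ.cutPoint θ ∈ γ.halfPocket 0 1 := by
  refine ⟨⟨⟨(neg_lt_cutPoint_re hθ hγ).le, ?_⟩, ?_⟩, ?_⟩ <;> rw [mem_ofPred_eq]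
  · linarith [cutPoint_re_neg hθ hγ, hγ.r_pos]
  · rw [cutPoint_im hθ]
    linarith [hγ.eta_pos, hγ.kappa_pos]
  · rw [cutPoint_im hθ]
    linarith [hγ.eta_pos]

lemma powMul_eq_of_re_pos (hθ : θ ∈ Ioo (Real.pi / 2) Real.pi) {z : ℂ}
    (hz : z ∈ {z : ℂ | 0 < z.re}) : powMul F s Real.pi z = powMul F s θ z := by
  rw [powMul, powMul, cutPow_eq_of_re_pos hθ hz]

lemma powMul_eq_of_im_neg (hθ : θ ∈ Ioo (Real.pi / 2) Real.pi) {z : ℂ}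
    (hz : z ∈ {z : ℂ | z.im < 0}) : powMul F s Real.pi z = powMul F s θ z := by
  rw [powMul, powMul, cutPow_eq_of_im_neg hθ hz]

lemma powMul_zero_eq_of_im_neg (hθ : θ ∈ Ioo (Real.pi / 2) Real.pi) {z : ℂ}
    (hz : z ∈ {z : ℂ | z.im < 0}) : powMul F s 0 z = powMul F s θ z := by
  rw [powMul, powMul, cutPow_eq_zero_of_im_neg hθ hz]

/-- The quadrant with corner `-r + iη` that contains the left part of the contour. It is to the left
of the cut because its corner is. -/
def leftQuadrant (γ : Contour) : Set ℂ := {z | z.re ≤ -γ.r} ∩ {z | z.im ≤ γ.η}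

lemma convex_leftQuadrant (γ : Contour) : Convex ℝ γ.leftQuadrant :=
  (convex_halfSpace_re_le _).inter (convex_halfSpace_im_le _)

lemma pt_mem_leftQuadrant {x y : ℝ} (hx : x ≤ -γ.r) (hy : y ≤ γ.η) : pt x y ∈ γ.leftQuadrant :=
  ⟨hx, hy⟩

lemma powMul_zero_eq_of_mem_leftQuadrant (hθ : θ ∈ Ioo (Real.pi / 2) Real.pi)
    (hγ : γ.Admissible θ σ) {z : ℂ} (hz : z ∈ γ.leftQuadrant) :
    powMul F s 0 z = powMul F s θ z := by
  have h1 := mul_le_mul_of_nonpos_right (show z.im ≤ γ.η from hz.2) (cos_neg_of_mem hθ).le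
  have h2 := mul_le_mul_of_nonneg_right (show z.re ≤ -γ.r from hz.1) (sin_pos_of_mem hθ).le
  rw [powMul, powMul, cutPow_eq_zero_of_left hθ (by linarith [hγ.corner_left])]

lemma pt_neg_kappa_mem_halfPocket (hγ : γ.Admissible θ σ) {x : ℝ} (hx : x = γ.r ∨ x = -γ.r) :
    pt x (-γ.κ) ∈ γ.halfPocket 0 (-1) :=
  ⟨pt_mem_pocket hγ hx (Or.inr rfl), by simpa [pt] using hγ.kappa_pos⟩

lemma pt_eta_mem_halfPocket (hγ : γ.Admissible θ σ) {x : ℝ} (hx : x = γ.r ∨ x = -γ.r) :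
    pt x γ.η ∈ γ.halfPocket 0 1 :=
  ⟨pt_mem_pocket hγ hx (Or.inl rfl), by simpa [pt] using hγ.eta_pos⟩

lemma pt_r_mem_halfPocket (hγ : γ.Admissible θ σ) {y : ℝ} (hy : y = γ.η ∨ y = -γ.κ) :
    pt γ.r y ∈ γ.halfPocket 1 0 :=
  ⟨pt_mem_pocket hγ (Or.inl rfl) hy, by simpa [pt] using hγ.r_pos⟩

lemma pt_neg_r_mem_halfPocket (hγ : γ.Admissible θ σ) {y : ℝ} (hy : y = γ.η ∨ y = -γ.κ) :
    pt (-γ.r) y ∈ γ.halfPocket (-1) 0 :=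
  ⟨pt_mem_pocket hγ (Or.inr rfl) hy, by simpa [pt] using hγ.r_pos⟩

lemma halfPocket_right_slit {z : ℂ} (hz : z ∈ γ.halfPocket 1 0) : z ∈ Complex.slitPlane :=
  Or.inl (halfPocket_re_pos hz)

lemma halfPocket_left_slit {z : ℂ} (hz : z ∈ γ.halfPocket (-1) 0) : -z ∈ Complex.slitPlane :=
  neg_mem_slitPlane_of_re_neg (halfPocket_re_neg hz)

/-- Inside the pocket, the contour is deformed to the segment of the cut from `0` to the height `η`,
traversed once on each side. The pocket is cut into five triangles with the vertex `0`. -/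
lemma segIntegral_pocket (hθ : θ ∈ Ioo (Real.pi / 2) Real.pi) (hγ : γ.Admissible θ σ)
    (hF : γ.IsDeformable F ε) (hs : s.re < 1) :
    segIntegral (powMul F s Real.pi) 0 (γ.cutPoint θ) +
        segIntegral (powMul F s Real.pi) (γ.cutPoint θ) (pt γ.r γ.η) +
        segIntegral (powMul F s θ) (pt γ.r γ.η) (pt γ.r (-γ.κ)) +
        segIntegral (powMul F s θ) (pt γ.r (-γ.κ)) (pt (-γ.r) (-γ.κ)) +
        segIntegral (powMul F s θ) (pt (-γ.r) (-γ.κ)) (pt (-γ.r) γ.η) +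
        segIntegral (powMul F s 0) (pt (-γ.r) γ.η) (γ.cutPoint θ) =
      segIntegral (powMul F s 0) 0 (γ.cutPoint θ) := by
  have hkη : -γ.κ ≤ γ.η := by linarith [hγ.kappa_pos, hγ.eta_pos]
  have t1 := triangle_pi hγ hF hs (a := 0) (b := 1)
    (fun z hz => mem_slitPlane_of_im_ne_zero (halfPocket_im_pos hz).ne')
    (cutPoint_mem_halfPocket hθ hγ) (pt_eta_mem_halfPocket hγ (Or.inl rfl))
  have t2 := triangle_pi hγ hF hs (a := 1) (b := 0) (fun z hz => halfPocket_right_slit hz)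
    (pt_r_mem_halfPocket hγ (Or.inl rfl)) (pt_r_mem_halfPocket hγ (Or.inr rfl))
  have t3 := triangle_pi hγ hF hs (a := 0) (b := -1)
    (fun z hz => mem_slitPlane_of_im_ne_zero (halfPocket_im_neg hz).ne)
    (pt_neg_kappa_mem_halfPocket hγ (Or.inl rfl)) (pt_neg_kappa_mem_halfPocket hγ (Or.inr rfl))
  have t4 := triangle_zero hγ hF hs (a := -1) (b := 0) (fun z hz => halfPocket_left_slit hz)
    (pt_neg_r_mem_halfPocket hγ (Or.inr rfl)) (pt_neg_r_mem_halfPocket hγ (Or.inl rfl))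
  have t5 := triangle_zero hγ hF hs (a := 0) (b := 1)
    (fun z hz => neg_mem_slitPlane_of_im_ne_zero (halfPocket_im_pos hz).ne')
    (pt_eta_mem_halfPocket hγ (Or.inr rfl)) (cutPoint_mem_halfPocket hθ hγ)
  -- below `0` both branches are the one of the integrand
  have hmid : segIntegral (powMul F s Real.pi) 0 (pt (-γ.r) (-γ.κ)) =
      segIntegral (powMul F s 0) 0 (pt (-γ.r) (-γ.κ)) := by
    refine segIntegral_congr fun u hu => ?_
    have him : (0 + (u : ℂ) * (pt (-γ.r) (-γ.κ) - 0)).im < 0 := by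
      rw [zero_add, sub_zero, Complex.im_ofReal_mul]
      exact mul_neg_of_pos_of_neg hu.1 (neg_neg_of_pos hγ.kappa_pos)
    rw [powMul_eq_of_im_neg hθ him, powMul_zero_eq_of_im_neg hθ him]
  have e2 := segIntegral_congr_of_convex (convex_halfSpace_re_gt 0)
    (fun z hz => powMul_eq_of_re_pos (F := F) (s := s) hθ hz) (p := pt γ.r γ.η)
    (q := pt γ.r (-γ.κ)) hγ.r_pos hγ.r_pos
  have e3 := segIntegral_congr_of_convex (convex_halfSpace_im_lt 0)
    (fun z hz => powMul_eq_of_im_neg (F := F) (s := s) hθ hz) (p := pt γ.r (-γ.κ))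
    (q := pt (-γ.r) (-γ.κ)) (neg_neg_of_pos hγ.kappa_pos) (neg_neg_of_pos hγ.kappa_pos)
  have e4 := segIntegral_congr_of_convex γ.convex_leftQuadrant
    (fun z hz => powMul_zero_eq_of_mem_leftQuadrant (F := F) (s := s) hθ hγ hz)
    (p := pt (-γ.r) (-γ.κ)) (q := pt (-γ.r) γ.η)
    (pt_mem_leftQuadrant le_rfl hkη) (pt_mem_leftQuadrant le_rfl le_rfl)
  rw [← e2, ← e3, ← e4]
  linear_combination t1 + t2 + t3 + t4 + t5 + hmid

lemma pt_neg_eta_im_neg (hγ : γ.Admissible θ σ) (x : ℝ) :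
    pt x (-γ.η) ∈ {z : ℂ | z.im < 0} := neg_neg_of_pos hγ.eta_pos

/-- The contour integral of the power times a deformable function is the difference of the
integrals over the two sides of the cut. -/
lemma integral_powMul_eq_sub (hθ : θ ∈ Ioo (Real.pi / 2) Real.pi) (hγ : γ.Admissible θ σ)
    (hF : γ.IsDeformable F ε) (hs0 : -ε < s.re) (hs : s.re < 1) :
    RayIntegrable (powMul F s Real.pi) 0 θ ∧ γ.integral (powMul F s θ) =
      rayIntegral (powMul F s 0) 0 θ - rayIntegral (powMul F s Real.pi) 0 θ := by
  have hη : -γ.η ≤ γ.η := by linarith [hγ.eta_pos]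
  have har : -γ.a ≤ -γ.r := by linarith [hγ.r_lt_a]
  have hδ : 0 < ε + s.re := by linarith
  have hT : 0 < γ.η / Real.sin θ := div_pos hγ.eta_pos (sin_pos_of_mem hθ)
  have hc0 : γ.cutPoint θ ≠ 0 := fun h => by
    have := cutPoint_im (γ := γ) hθ
    rw [h, Complex.zero_im] at this
    exact hγ.eta_pos.ne this
  have hpos : ∀ z ∈ γ.halfPocket 0 1, z.im ≠ 0 := fun z hz => (halfPocket_im_pos hz).ne'
  have hmem : ∀ u : ℝ, 0 < u → u ≤ 1 → (u : ℂ) * γ.cutPoint θ ∈ γ.halfPocket 0 1 :=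
    fun u hu0 hu => smul_mem_halfPocket hγ (cutPoint_mem_halfPocket hθ hγ) hu0 hu
  have hσ : max s.re 0 < 1 := max_lt hs one_pos
  have gR := rayIntegral_zero_eq_add hT
    (segIntegrable_zero hσ hc0 (differentiableOn_powMul_pi (s := s) hF.diff
      (γ.halfPocket_subset 0 1) fun z hz => mem_slitPlane_of_im_ne_zero (hpos z hz)).continuousOn
      (hF.singularOn Real.pi_pos.le le_rfl (γ.halfPocket_subset 0 1)) hmem)
    (rayIntegrable_of_decaysOn hδ (differentiableOn_powMul_upperPart hγ hF).1.continuousOn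
      (hF.decaysOn Real.pi_pos.le le_rfl (upperPart_subset_sdiff hγ))
      fun u hu => cutRay_mem hθ hγ hu)
  have gL := rayIntegral_zero_eq_add hT
    (segIntegrable_zero hσ hc0 (differentiableOn_powMul_zero (s := s) hF.diff
      (γ.halfPocket_subset 0 1) fun z hz =>
        neg_mem_slitPlane_of_im_ne_zero (hpos z hz)).continuousOn
      (hF.singularOn le_rfl Real.pi_pos.le (γ.halfPocket_subset 0 1)) hmem)
    (rayIntegrable_of_decaysOn hδ (differentiableOn_powMul_upperPart hγ hF).2.continuousOn
      (hF.decaysOn le_rfl Real.pi_pos.le (upperPart_subset_sdiff hγ))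
      fun u hu => cutRay_mem hθ hγ hu)
  refine ⟨gR.1, ?_⟩
  have u1 := rayIntegral_upper hθ hγ hF hs0
  have u2 := rayIntegral_left hθ hγ hF hs0
  have pk := segIntegral_pocket hθ hγ hF hs
  have sw := segIntegral_swap (powMul F s Real.pi) (pt γ.r γ.η) (γ.cutPoint θ)
  have sw' := segIntegral_swap (powMul F s 0) (γ.cutPoint θ) (pt (-γ.r) γ.η)
  have e1 : rayIntegral (powMul F s Real.pi) (pt γ.r γ.η) γ.φ =
      rayIntegral (powMul F s θ) (pt γ.r γ.η) γ.φ :=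
    rayIntegral_congr fun u hu => powMul_eq_of_re_pos hθ (by
      rw [mem_ofPred_eq, add_mul_exp_re]
      exact add_pos_of_pos_of_nonneg hγ.r_pos (mul_nonneg (le_of_lt hu) hγ.cos_pos.le))
  have e8 : rayIntegral (powMul F s 0) (pt γ.r (-γ.η)) (-γ.φ) =
      rayIntegral (powMul F s θ) (pt γ.r (-γ.η)) (-γ.φ) :=
    rayIntegral_congr fun u hu => powMul_zero_eq_of_im_neg hθ
      (im_neg_of_mem_lowerPart hγ (lowerRay_mem hγ (le_of_lt hu)))
  have hq := fun z hz => powMul_zero_eq_of_mem_leftQuadrant (F := F) (s := s) (z := z) hθ hγ hz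
  have e5 := segIntegral_congr_of_convex γ.convex_leftQuadrant hq (p := pt (-γ.r) γ.η)
    (q := pt (-γ.a) γ.η) (pt_mem_leftQuadrant le_rfl le_rfl) (pt_mem_leftQuadrant har le_rfl)
  have e6 := segIntegral_congr_of_convex γ.convex_leftQuadrant hq (p := pt (-γ.a) γ.η)
    (q := pt (-γ.a) (-γ.η)) (pt_mem_leftQuadrant har le_rfl) (pt_mem_leftQuadrant har hη)
  have e7 := segIntegral_congr_of_convex (convex_halfSpace_im_lt 0)
    (fun z hz => powMul_zero_eq_of_im_neg (F := F) (s := s) hθ hz) (p := pt (-γ.a) (-γ.η))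
    (q := pt γ.r (-γ.η)) (pt_neg_eta_im_neg hγ _) (pt_neg_eta_im_neg hγ _)
  rw [gR.2, gL.2, integral, ← e1, ← e5, ← e6, ← e7, ← e8, u1, sw]
  change _ = segIntegral (powMul F s 0) 0 (γ.cutPoint θ) +
    rayIntegral (powMul F s 0) (γ.cutPoint θ) θ -
    (segIntegral (powMul F s Real.pi) 0 (γ.cutPoint θ) +
      rayIntegral (powMul F s Real.pi) (γ.cutPoint θ) θ)
  rw [u2, sw']
  linear_combination pk

/-- The contour integral of the power times a deformable function converges absolutely. -/
lemma integrable_powMul (hθ : θ ∈ Ioo (Real.pi / 2) Real.pi) (hγ : γ.Admissible θ σ)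
    (hF : γ.IsDeformable F ε) (hs0 : -ε < s.re) : γ.Integrable (powMul F s θ) := by
  have hη : -γ.η ≤ γ.η := by linarith [hγ.eta_pos]
  have hkη : -γ.κ ≤ γ.η := by linarith [hγ.kappa_pos, hγ.eta_pos]
  have har : -γ.a ≤ -γ.r := by linarith [hγ.r_lt_a]
  have hr := hγ.r_pos
  have hδ : 0 < ε + s.re := by linarith
  have hq := fun z hz => powMul_zero_eq_of_mem_leftQuadrant (F := F) (s := s) (z := z) hθ hγ hz
  have dU := differentiableOn_powMul_upperPart (s := s) hγ hF
  have dL := differentiableOn_powMul_lowerPart (s := s) hγ hF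
  have hupper : ∀ x : ℝ, x ≤ γ.r → pt x γ.η ∈ γ.upperPart := fun x hx =>
    mem_upperPart_of_re_le hγ le_rfl hx
  have hlower : ∀ x : ℝ, x ≤ γ.r → pt x (-γ.η) ∈ γ.lowerPart := fun x hx =>
    mem_lowerPart_of_re_le hγ le_rfl hx
  refine ⟨?_, ?_, ?_, ?_, ?_, ?_, ?_, ?_⟩
  · refine RayIntegrable.congr (rayIntegrable_of_decaysOn hδ dU.1.continuousOn
      (hF.decaysOn Real.pi_pos.le le_rfl (upperPart_subset_sdiff hγ))
      fun u hu => upperRay_mem hγ hu) fun u hu => powMul_eq_of_re_pos hθ ?_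
    rw [mem_ofPred_eq, add_mul_exp_re]
    exact add_pos_of_pos_of_nonneg hγ.r_pos (mul_nonneg (le_of_lt hu) hγ.cos_pos.le)
  · exact (segIntegrable_of_continuousOn (γ.convex_halfPocket 1 0)
      (differentiableOn_powMul_pi hF.diff (γ.halfPocket_subset 1 0)
        fun z hz => halfPocket_right_slit hz).continuousOn
      (pt_r_mem_halfPocket hγ (Or.inl rfl)) (pt_r_mem_halfPocket hγ (Or.inr rfl))
      ).congr_of_convex (convex_halfSpace_re_gt 0) (fun z hz => powMul_eq_of_re_pos hθ hz) hr hr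
  · exact (segIntegrable_of_continuousOn (γ.convex_halfPocket 0 (-1))
      (differentiableOn_powMul_pi hF.diff (γ.halfPocket_subset 0 (-1))
        fun z hz => mem_slitPlane_of_im_ne_zero (halfPocket_im_neg hz).ne).continuousOn
      (pt_neg_kappa_mem_halfPocket hγ (Or.inl rfl)) (pt_neg_kappa_mem_halfPocket hγ (Or.inr rfl))
      ).congr_of_convex (convex_halfSpace_im_lt 0) (fun z hz => powMul_eq_of_im_neg hθ hz)
      (neg_neg_of_pos hγ.kappa_pos) (neg_neg_of_pos hγ.kappa_pos)
  · exact (segIntegrable_of_continuousOn (γ.convex_halfPocket (-1) 0)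
      (differentiableOn_powMul_zero hF.diff (γ.halfPocket_subset (-1) 0)
        fun z hz => halfPocket_left_slit hz).continuousOn
      (pt_neg_r_mem_halfPocket hγ (Or.inr rfl)) (pt_neg_r_mem_halfPocket hγ (Or.inl rfl))
      ).congr_of_convex γ.convex_leftQuadrant hq (pt_mem_leftQuadrant le_rfl hkη)
      (pt_mem_leftQuadrant le_rfl le_rfl)
  · exact (segIntegrable_of_continuousOn γ.convex_upperPart dU.2.continuousOn
      (hupper _ (by linarith)) (hupper _ (by linarith))).congr_of_convex γ.convex_leftQuadrant hq
      (pt_mem_leftQuadrant le_rfl le_rfl) (pt_mem_leftQuadrant har le_rfl)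
  · exact (segIntegrable_of_continuousOn (convex_halfSpace_re_le (-γ.a))
      (differentiableOn_powMul_left hγ hF).continuousOn (p := pt (-γ.a) γ.η)
      (q := pt (-γ.a) (-γ.η)) (le_refl (-γ.a)) (le_refl (-γ.a))).congr_of_convex
      γ.convex_leftQuadrant hq (pt_mem_leftQuadrant har le_rfl) (pt_mem_leftQuadrant har hη)
  · exact (segIntegrable_of_continuousOn γ.convex_lowerPart dL.continuousOn
      (hlower _ (by linarith)) (hlower _ le_rfl)).congr_of_convex (convex_halfSpace_im_lt 0)
      (fun z hz => powMul_zero_eq_of_im_neg hθ hz) (pt_neg_eta_im_neg hγ _)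
      (pt_neg_eta_im_neg hγ _)
  · exact RayIntegrable.congr (rayIntegrable_of_decaysOn hδ dL.continuousOn
      (hF.decaysOn le_rfl Real.pi_pos.le (lowerPart_subset_sdiff hγ))
      fun u hu => lowerRay_mem hγ hu) fun u hu => powMul_zero_eq_of_im_neg hθ
      (im_neg_of_mem_lowerPart hγ (lowerRay_mem hγ (le_of_lt hu)))

/-- The integral of `t^{-s} F(t e^{iθ})` along the cut. -/
lemma integral_powMul (hθ : θ ∈ Ioo (Real.pi / 2) Real.pi) (hγ : γ.Admissible θ σ)
    (hF : γ.IsDeformable F ε) (hs0 : -ε < s.re) (hs : s.re < 1) :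
    IntegrableOn (fun t : ℝ => (t : ℂ) ^ (-s) * F (Complex.exp (θ * Complex.I) * t)) (Ioi 0) ∧
      γ.integral (powMul F s θ) = (Complex.exp (2 * Real.pi * s * Complex.I) - 1) *
        Complex.exp (-(s * θ * Complex.I)) * ∫ t in Ioi (0 : ℝ),
          (t : ℂ) ^ (-s) * (Complex.exp (θ * Complex.I) * F (Complex.exp (θ * Complex.I) * t)) := by
  obtain ⟨h1, h2⟩ := integral_powMul_eq_sub hθ hγ hF hs0 hs
  have ePi : ∀ t ∈ Ioi (0 : ℝ), powMul F s Real.pi (0 + t * Complex.exp (θ * Complex.I)) =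
      Complex.exp (-(s * θ * Complex.I)) *
        ((t : ℂ) ^ (-s) * F (Complex.exp (θ * Complex.I) * t)) := fun t ht => by
    rw [zero_add, powMul, cutPow_pi_cut hθ ht, mul_assoc, mul_comm (t : ℂ)]
  constructor
  · have h3 := (IntegrableOn.congr_fun h1 ePi measurableSet_Ioi).const_mul
      (Complex.exp (s * θ * Complex.I))
    refine IntegrableOn.congr_fun h3 (fun t _ => ?_) measurableSet_Ioi
    rw [← mul_assoc, ← Complex.exp_add, add_neg_cancel, Complex.exp_zero, one_mul]
  · have hPi : rayIntegral (powMul F s Real.pi) 0 θ = Complex.exp (-(s * θ * Complex.I)) *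
        ∫ t in Ioi (0 : ℝ), (t : ℂ) ^ (-s) *
          (Complex.exp (θ * Complex.I) * F (Complex.exp (θ * Complex.I) * t)) := by
      rw [rayIntegral, ← integral_const_mul]
      refine setIntegral_congr_fun measurableSet_Ioi fun t ht => ?_
      simp only [ePi t ht]
      ring
    have hZero : rayIntegral (powMul F s 0) 0 θ =
        Complex.exp (2 * Real.pi * s * Complex.I) * rayIntegral (powMul F s Real.pi) 0 θ := by
      rw [rayIntegral, rayIntegral, ← integral_const_mul]
      refine setIntegral_congr_fun measurableSet_Ioi fun t ht => ?_
      simp only [powMul, zero_add]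
      rw [cutPow_zero_cut hθ ht]
      ring
    rw [h2, hZero, hPi]
    ring

end Contour

/-! ### The zeta function -/

section Zeta

variable {H : Type*} [NormedAddCommGroup H] [InnerProductSpace ℂ H]

lemma mem_resolventSet_of_notMem_inside {S₁ S₂ : H →ₗ.[ℂ] H} {γ : Contour}
    (hγ : (spectrum S₁ ∪ spectrum S₂) \ {0} ⊆ γ.inside) {z : ℂ} (hz : z ∈ γ.insideᶜ \ {0}) :
    z ∈ (resolventSet S₁ ∩ resolventSet S₂) \ {0} := by
  have h : z ∉ spectrum S₁ ∪ spectrum S₂ := fun h => hz.1 (hγ ⟨h, hz.2⟩)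
  exact ⟨⟨not_not.mp fun h1 => h (Or.inl h1), not_not.mp fun h2 => h (Or.inr h2)⟩, hz.2⟩

lemma notMem_spectralHalfLine {S₁ S₂ : H →ₗ.[ℂ] H} {z : ℂ} (hz : z.im ≠ 0) :
    z ∉ spectralHalfLine S₁ S₂ := by
  rintro ⟨x, -, rfl⟩
  exact hz (Complex.ofReal_im x)

variable [CompleteSpace H]

lemma isDeformable_redTrace {S₁ S₂ : H →ₗ.[ℂ] H} [FiniteDimensional ℂ (eigenspace S₁ 0)]
    [FiniteDimensional ℂ (eigenspace S₂ 0)]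
    (htc : ∃ z ∈ resolventSet S₁ ∩ resolventSet S₂, IsTraceClass (resolvent S₂ z - resolvent S₁ z))
    {γ : Contour} {ε : ℝ} (hγ : (spectrum S₁ ∪ spectrum S₂) \ {0} ⊆ γ.inside)
    (hinf : redTrace S₁ S₂ =O[Bornology.cobounded ℂ ⊓ 𝓟 γ.insideᶜ] fun z => ‖z‖ ^ (-1 - ε))
    (hzero : redTrace S₁ S₂ =O[𝓝[≠] 0] fun _ => (1 : ℝ)) :
    γ.IsDeformable (redTrace S₁ S₂) ε := by
  refine ⟨(differentiableOn_redTrace htc).mono fun z hz =>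
    mem_resolventSet_of_notMem_inside hγ hz, ?_, ?_⟩
  · obtain ⟨C, hC⟩ := hinf.bound
    rw [eventually_inf_principal, ← comap_norm_atTop, eventually_comap] at hC
    obtain ⟨R, hR⟩ := eventually_atTop.mp hC
    refine ⟨C, R, fun z hz hzR => ?_⟩
    have h := hR _ hzR z rfl hz
    rwa [Real.norm_of_nonneg (by positivity)] at h
  · obtain ⟨C, hC⟩ := hzero.bound
    obtain ⟨ρ, hρ, h⟩ := Metric.eventually_nhds_iff.mp (eventually_nhdsWithin_iff.mp hC)
    refine ⟨C, ρ / 2, by positivity, fun z hz hzρ => ?_⟩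
    have h1 := h (y := z) (by rw [dist_zero_right]; linarith) hz
    simpa using h1

/-- The exterior of the contour contains the cut. -/
lemma cut_subset {γ : Contour} {θ : ℝ} {σ : Set ℂ} (hθ : θ ∈ Ioo (Real.pi / 2) Real.pi)
    (hγ : γ.Admissible θ σ) {t : ℝ} (ht : 0 < t) :
    Complex.exp (θ * Complex.I) * t ∈ γ.insideᶜ \ {0} := by
  have hsin := Contour.sin_pos_of_mem hθ
  have hcos := Contour.cos_neg_of_mem hθ
  have him : (Complex.exp (θ * Complex.I) * t).im = Real.sin θ * t := by
    rw [Complex.im_mul_ofReal, Complex.exp_ofReal_mul_I_im]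
  have hre : (Complex.exp (θ * Complex.I) * t).re = Real.cos θ * t := by
    rw [Complex.re_mul_ofReal, Complex.exp_ofReal_mul_I_re]
  have h1 := mul_pos hsin ht
  have h2 := mul_neg_of_neg_of_pos hcos ht
  refine ⟨?_, fun h => ?_⟩
  · rcases le_total γ.η (Real.sin θ * t) with h | h
    · exact (Contour.upperPart_subset_sdiff hγ (Contour.mem_upperPart_of_re_le hγ (by rwa [him])
        (by rw [hre]; linarith [hγ.r_pos]))).1
    · -- below the height `η` the cut is to the right of `-r`
      have h3 := mul_le_mul_of_nonpos_right h hcos.le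
      have h4 : -γ.r ≤ Real.cos θ * t := by
        by_contra hcon
        push Not at hcon
        have := mul_lt_mul_of_pos_right hcon hsin
        linarith [hγ.corner_left]
      refine γ.pocket_subset ⟨⟨?_, ?_⟩, ?_⟩ <;> rw [mem_ofPred_eq]
      · rwa [hre]
      · rw [hre]
        linarith [hγ.r_pos]
      · rw [him]
        linarith [hγ.kappa_pos]
  · have h3 : Complex.exp (θ * Complex.I) * t = 0 := h
    rw [h3, Complex.zero_im] at him
    exact h1.ne him

/-- The factor in front of the integral along the cut. -/
lemma zeta_factor (s : ℂ) (θ : ℝ) :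
    (2 * Real.pi * Complex.I)⁻¹ * ((Complex.exp (2 * Real.pi * s * Complex.I) - 1) *
      Complex.exp (-(s * θ * Complex.I))) =
    Complex.exp (Complex.I * s * (Real.pi - θ)) * (Real.pi : ℂ)⁻¹ * Complex.sin (Real.pi * s) := by
  have e1 : Complex.exp (2 * Real.pi * s * Complex.I) =
      Complex.exp (Real.pi * s * Complex.I) * Complex.exp (Real.pi * s * Complex.I) := by
    rw [← Complex.exp_add]
    congr 1
    ring
  have e2 : Complex.exp (Complex.I * s * (Real.pi - θ)) =
      Complex.exp (Real.pi * s * Complex.I) * Complex.exp (-(s * θ * Complex.I)) := by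
    rw [← Complex.exp_add]
    congr 1
    ring
  have e3 : Complex.exp (-(Real.pi * s) * Complex.I) *
      Complex.exp (Real.pi * s * Complex.I) = 1 := by
    rw [← Complex.exp_add]
    simp
  rw [e1, e2, Complex.sin, mul_inv, mul_inv, Complex.inv_I]
  linear_combination (-(2⁻¹ * (Real.pi : ℂ)⁻¹ * Complex.I *
    Complex.exp (-(s * θ * Complex.I)))) * e3

end Zeta

end RelZeta

open RelZeta in
theorem theorem14 {H : Type*} [NormedAddCommGroup H] [InnerProductSpace ℂ H] [CompleteSpace H]
    [TopologicalSpace.SeparableSpace H]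
    (S₁ S₂ : H →ₗ.[ℂ] H)
    (hS₁ : IsSelfAdjoint S₁) (hS₂ : IsSelfAdjoint S₂)
    (hb₁ : BoundedBelow S₁) (hb₂ : BoundedBelow S₂)
    -- the difference of the resolvents is trace class
    (htc : ∃ z ∈ resolventSet S₁ ∩ resolventSet S₂, IsTraceClass (resolvent S₂ z - resolvent S₁ z))
    -- the essential spectra are contained in `[l, ∞)` with `l > 0`
    (l : ℝ) (hl : 0 < l)
    (hess₁ : essSpectrum S₁ ⊆ (fun x : ℝ => (x : ℂ)) '' Set.Ici l)
    (hess₂ : essSpectrum S₂ ⊆ (fun x : ℝ => (x : ℂ)) '' Set.Ici l)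
    -- the trace of the difference of the resolvents is minus the logarithmic derivative of the
    -- symmetrized determinant, which is well-defined and does not vanish
    (hdef : ∀ z ∉ spectralHalfLine S₁ S₂, SymmDetDefined S₁ S₂ z ∧ symmDet S₁ S₂ z ≠ 0)
    (hdet : ∀ z ∉ spectralHalfLine S₁ S₂, DifferentiableAt ℂ (symmDet S₁ S₂) z ∧
      RelZeta.trace (resolvent S₂ z - resolvent S₁ z) = -logDeriv (symmDet S₁ S₂) z)
    -- the branch cut and the contour
    (θ : ℝ) (hθ : θ ∈ Set.Ioo (Real.pi / 2) Real.pi)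
    (γ : Contour) (hγ : γ.Admissible θ (RelZeta.spectrum S₁ ∪ RelZeta.spectrum S₂))
    -- the behaviour at infinity (on and outside the contour) and at zero
    (ε : ℝ) (hε : 0 < ε)
    (hinf : redTrace S₁ S₂ =O[Bornology.cobounded ℂ ⊓ 𝓟 γ.insideᶜ] fun z => ‖z‖ ^ (-1 - ε))
    (hzero : redTrace S₁ S₂ =O[𝓝[≠] 0] fun _ => (1 : ℝ)) :
    (∀ s : ℂ, -ε < s.re → γ.Integrable (zetaIntegrand S₁ S₂ θ s)) ∧
    ∀ s : ℂ, -ε < s.re → s.re < 1 →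
      IntegrableOn (cutIntegrand S₁ S₂ θ s) (Set.Ioi 0) ∧
      relZeta S₁ S₂ θ γ s =
        Complex.exp (Complex.I * s * (Real.pi - θ)) * (Real.pi : ℂ)⁻¹ * Complex.sin (Real.pi * s) *
          ∫ t in Set.Ioi (0 : ℝ), cutIntegrand S₁ S₂ θ s t := by
  have := finiteDimensional_eigenspace_zero (zero_notMem_essSpectrum hl hess₁)
  have := finiteDimensional_eigenspace_zero (zero_notMem_essSpectrum hl hess₂)
  have hF := isDeformable_redTrace htc hγ.encloses hinf hzero
  refine ⟨fun s hs => Contour.integrable_powMul hθ hγ hF hs, fun s hs0 hs => ?_⟩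
  obtain ⟨h1, h2⟩ := Contour.integral_powMul hθ hγ hF hs0 hs
  have hcut : ∀ t ∈ Set.Ioi (0 : ℝ), cutIntegrand S₁ S₂ θ s t = -((t : ℂ) ^ (-s) *
      (Complex.exp (θ * Complex.I) * redTrace S₁ S₂ (Complex.exp (θ * Complex.I) * t))) := by
    intro t ht
    have hmem := cut_subset hθ hγ ht
    have him : (Complex.exp (θ * Complex.I) * t).im ≠ 0 := by
      rw [Complex.im_mul_ofReal, Complex.exp_ofReal_mul_I_im]
      exact (mul_pos (Contour.sin_pos_of_mem hθ) ht).ne'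
    have hhl := notMem_spectralHalfLine (S₁ := S₁) (S₂ := S₂) him
    rw [cutIntegrand, logDeriv_zpow_mul_symmDet htc hmem.2
      (mem_resolventSet_of_notMem_inside hγ.encloses hmem).1 (hdef _ hhl).2 (hdet _ hhl).1
      (hdet _ hhl).2, mul_neg]
  constructor
  · refine IntegrableOn.congr_fun (h1.const_mul (-Complex.exp (θ * Complex.I)))
      (fun t ht => ?_) measurableSet_Ioi
    rw [hcut t ht]
    ring
  · rw [setIntegral_congr_fun measurableSet_Ioi hcut, integral_neg, ← zeta_factor, relZeta]
    have h2' : γ.integral (zetaIntegrand S₁ S₂ θ s) = _ := h2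
    rw [h2']
    ring
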